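/- Let $G=(V,E)$ be a finite simple graph. A *square* is a (not necessarily induced) cycle of length four in $G$; it is *chordless* if it is induced. Two edges $e,f\in E$ are in relation $\delta(G)$ if (i) $e$ and $f$ are adjacent and it is not the case that they span exactly one square and that this square is chordless, or (ii) $e$ and $f$ are opposite edges of a chordless square, or (iii) $e=f$. For $v\in V$ let $E_v$ be the set of edges incident to $v$ and let $\mathfrak d_v=((E_v\times E)\cup(E\times E_v))\cap\delta(G)$. A star denotes the transitive closure of a relation. Let $F_v$ be the set of all edges that are opposite to $e$ or to $e'$ in a chordless square spanned by edges $e,e'\in E_v$ with $(e,e')\notin\mathfrak d_v^*$. The *partial star product* $S_v$ is the subgraph of $G$ with edge set $E_v\cup F_v$ whose vertices are the end vertices of these edges, and $\mathfrak d_{|S_v}=\{(e,f)\in\mathfrak d_v^* : e,f\in E(S_v)\}$. For $W\subseteq V$ let $\mathfrak d_{|S_v}(W)=\bigcup_{v\in W}\mathfrak d_{|S_v}$; its transitive closure $\mathfrak d_{|S_v}(W)^*$ is considered as an equivalence relation on the edge set of $\bigcup_{v\in W}S_v$. Consider the following algorithm with input $G$ (by adjacency lists, in any order) and $W$ (as a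 list, in any order). It maintains an initially empty *color graph* $\Gamma$. It scans the vertices $v\in W$ one after the other. For each $v$ it determines $S_v$ and the equivalence classes of $\mathfrak d_{|S_v}$ (by evaluating $\delta$ on pairs of edges of which one is incident to $v$), adds one new color for each class as a new vertex of $\Gamma$, and gives every edge of $S_v$ the color of its class; whenever an edge already has a color $x$ and gets a new color $y$, the vertices $x$ and $y$ are joined in $\Gamma$. After that it computes the connected components of $\Gamma$ and puts two colored edges into the same output class if and only if their colors lie in the same component. The algorithm is implemented as an explicit program for a random access machine with zero-initialised memory, in which each load, store, successor operation, comparison and loop iteration takes one unit of time. There is an absolute constant $C$ such that the following holds for every finite simple graph $G=(V,E)$ with maximum degree $\Delta$ and every $W\subseteq V$ for which the induced subgraph $\langle W\rangle$ is connected (in particular non-empty). For every numbering of $V$ and every order of the input lists, the program outputs the graph $\bigcup_{v\in W}S_v$ (its vertices and edges, each listed exactly once) and the equivalence classes of $\mathfrak d_{|S_v}(W)^*$ (each exactly once), and it stops after at most $C\,|V|\,\max(1,\Delta)^4$ steps. In particular, for $\Delta\ge 1$ the running time is $O(|V|\Delta^4)$. -/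

import Mathlib

namespace PSP

/-! ## Partial star products -/

section Graph

variable {V : Type*}

/-- `a b c d` is a square (a cycle of length four, not necessarily induced) of `G`,
with vertices listed in cyclic order. -/
def IsSquare (G : SimpleGraph V) (a b c d : V) : Prop :=
  G.Adj a b ∧ G.Adj b c ∧ G.Adj c d ∧ G.Adj d a ∧ a ≠ c ∧ b ≠ d

/-- `a b c d` is a square of `G` without chords. -/
def IsChordlessSquare (G : SimpleGraph V) (a b c d : V) : Prop :=
  IsSquare G a b c d ∧ ¬ G.Adj a c ∧ ¬ G.Adj b d

/-- The adjacent edges `vu` and `vw` span a unique square, and this square is chordless.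
A square spanned by `vu` and `vw` is determined by its fourth vertex. -/
def SpanUniqueChordlessSquare (G : SimpleGraph V) (v u w : V) : Prop :=
  ∃ x, IsChordlessSquare G v u x w ∧ ∀ y, IsSquare G v u y w → y = x

/-- The relation `δ(G)` on the edge set of `G`. -/
def delta (G : SimpleGraph V) (e f : Sym2 V) : Prop :=
  e ∈ G.edgeSet ∧ f ∈ G.edgeSet ∧
    ((∃ v u w, u ≠ w ∧ e = s(v, u) ∧ f = s(v, w) ∧ ¬ SpanUniqueChordlessSquare G v u w) ∨
      (∃ a b c d, IsChordlessSquare G a b c d ∧ e = s(a, b) ∧ f = s(c, d)) ∨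
      e = f)

/-- The local relation `𝔡_v = ((E_v × E) ∪ (E × E_v)) ∩ δ(G)`, where `E_v` is the set of
edges incident to `v`. -/
def localRel (G : SimpleGraph V) (v : V) (e f : Sym2 V) : Prop :=
  (e ∈ G.incidenceSet v ∨ f ∈ G.incidenceSet v) ∧ delta G e f

/-- The transitive closure `𝔡_v^*`. -/
def localRelStar (G : SimpleGraph V) (v : V) : Sym2 V → Sym2 V → Prop :=
  Relation.TransGen (localRel G v)

/-- The non-primal edges `F_v`: those edges that are opposite, in a chordless square spanned by
`e, e' ∈ E_v` with `(e, e') ∉ 𝔡_v^*`, to `e` or to `e'`. -/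
def nonPrimalEdges (G : SimpleGraph V) (v : V) : Set (Sym2 V) :=
  {g | ∃ u x w, IsChordlessSquare G v u x w ∧ ¬ localRelStar G v s(v, u) s(v, w) ∧
    (g = s(u, x) ∨ g = s(w, x))}

/-- The edge set `E_v ∪ F_v` of the partial star product. -/
def pspEdges (G : SimpleGraph V) (v : V) : Set (Sym2 V) :=
  G.incidenceSet v ∪ nonPrimalEdges G v

theorem pspEdges_subset (G : SimpleGraph V) (v : V) : pspEdges G v ⊆ G.edgeSet := by
  rintro e (he | ⟨u, x, w, hs, -, rfl | rfl⟩)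
  · exact he.1
  · exact hs.1.2.1
  · exact hs.1.2.2.1.symm

/-- The partial star product `S_v`: edge set `E_v ∪ F_v`, vertex set the union of these edges. -/
def psp (G : SimpleGraph V) (v : V) : G.Subgraph where
  verts := {x | ∃ e ∈ pspEdges G v, x ∈ e}
  Adj x y := s(x, y) ∈ pspEdges G v
  adj_sub h := pspEdges_subset G v h
  edge_vert h := ⟨_, h, Sym2.mem_mk_left _ _⟩
  symm := ⟨fun x y h => by rwa [Sym2.eq_swap]⟩

/-- The union `⋃_{v ∈ W} S_v`, a subgraph of `G`. -/
def pspUnion (G : SimpleGraph V) (W : Set V) : G.Subgraph := ⨆ v ∈ W, psp G v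

/-- `𝔡_{|S_v}`, the restriction of `𝔡_v^*` to the edges of `S_v`. -/
def pspRel (G : SimpleGraph V) (v : V) (e f : Sym2 V) : Prop :=
  localRelStar G v e f ∧ e ∈ (psp G v).edgeSet ∧ f ∈ (psp G v).edgeSet

/-- `𝔡_{|S_v}(W)`, the union of the relations `𝔡_{|S_v}` over `v ∈ W`. -/
def pspRelOn (G : SimpleGraph V) (W : Set V) (e f : Sym2 V) : Prop :=
  ∃ v ∈ W, pspRel G v e f

/-- `𝔡_{|S_v}(W)^*`, the transitive closure of `𝔡_{|S_v}(W)`. -/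
def pspRelOnStar (G : SimpleGraph V) (W : Set V) : Sym2 V → Sym2 V → Prop :=
  Relation.TransGen (pspRelOn G W)

/-- The equivalence classes of `𝔡_{|S_v}(W)^*` on the edge set of `⋃_{v ∈ W} S_v`. -/
def pspClasses (G : SimpleGraph V) (W : Set V) : Set (Set (Sym2 V)) :=
  {φ | ∃ e ∈ (pspUnion G W).edgeSet, φ = {f | pspRelOnStar G W e f}}

end Graph

/-! ## Random access machine

The memory consists of finitely many named arrays of natural numbers, each addressed by a pair of
natural numbers (one-dimensional arrays use second index `0`, scalars use the indices `0 0`).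
A program is written over an abstract type `ν` of machine words, so that the primitive
instructions below, each of which is charged, are the only way to handle words. -/

/-- The names of the arrays. The first five hold the input. -/
inductive Arr : Type
  | size      -- the number of vertices
  | deg       -- `deg v`: the degree of `v`
  | nbr       -- `nbr v k`: the `k`-th neighbour of `v`
  | wLen      -- the cardinality of `W`
  | wList     -- the elements of `W`
  | adj       -- adjacency matrix
  | count     -- counter for squares
  | chord     -- flag: a square with a chord was seen
  | hit       -- `hit i`: the `i`-th edge at `v` is related to the current edge
  | loc       -- relation on the positions of the edges at `v`
  | old       -- flag: the current position belongs to an earlier class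
  | locCol    -- `locCol i`: the colour of the `i`-th edge at `v`
  | numCol    -- number of colours in use (vertices of the colour graph)
  | col       -- `col a b`: the current colour of the edge `ab`, `0` if not coloured
  | gLen      -- degrees in the colour graph
  | gNbr      -- adjacency lists of the colour graph
  | comp      -- `comp c`: the component of colour `c`, `0` if not yet visited
  | queue     -- queue for breadth-first search
  | qHead
  | qTail
  | seen      -- vertices already in the output subgraph
  | vLen      -- output: number of vertices of the subgraph
  | vList     -- output: its vertices
  | eLen      -- output: number of edges of the subgraph
  | eFst      -- output: first end vertices of its edges
  | eSnd      -- output: second end vertices of its edges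
  | numComp   -- output: number of classes
  | clsLen    -- output: `clsLen k`: the length of the list of class `k`
  | cls       -- output: `cls k t`: the index of the `t`-th edge of class `k`
  deriving DecidableEq

/-- Memory contents. -/
abbrev Mem : Type := Arr → ℕ → ℕ → ℕ

/-- Memory after writing `x` into cell `(i, j)` of the array `A`. -/
def Mem.set (M : Mem) (A : Arr) (i j x : ℕ) : Mem :=
  fun B k l => if B = A ∧ k = i ∧ l = j then x else M B k l

/-- Programs over a type `ν` of machine words that return a value of type `α`. -/
inductive Prog (ν : Type) : Type → Type 1
  | ret {α : Type} (a : α) : Prog ν α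
  | andThen {α β : Type} (p : Prog ν α) (q : α → Prog ν β) : Prog ν β
  | zero : Prog ν ν
  | succ (x : ν) : Prog ν ν
  | eq (x y : ν) : Prog ν Bool
  | lt (x y : ν) : Prog ν Bool
  | load (A : Arr) (i j : ν) : Prog ν ν
  | store (A : Arr) (i j x : ν) : Prog ν Unit
  /-- Run `body 0`, `body 1`, …, `body (n - 1)`. -/
  | forLoop (n : ν) (body : ν → Prog ν Unit) : Prog ν Unit
  /-- Run `body` as long as `test` succeeds, but at most `n` times. -/
  | whileLoop (n : ν) (test : Prog ν Bool) (body : Prog ν Unit) : Prog ν Unit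

instance (ν : Type) : Monad (Prog ν) where
  pure := Prog.ret
  bind := Prog.andThen

/-- The outcome of a run: the returned value, the final memory, and the number of steps. -/
structure Outcome (α : Type) : Type where
  val : α
  mem : Mem
  steps : ℕ

/-- Semantics of `forLoop`: one step for the exit, and one step for each iteration in addition to
the steps of the body. -/
def runFor (body : ℕ → Mem → Outcome Unit) : ℕ → Mem → Outcome Unit
  | 0, M => ⟨(), M, 1⟩
  | n + 1, M =>
    let r := runFor body n M
    let s := body n r.mem
    ⟨(), s.mem, r.steps + s.steps + 1⟩

/-- Semantics of `whileLoop`: one step for the exit, and one step for each round in addition to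
the steps of the test and of the body. -/
def runWhile (test : Mem → Outcome Bool) (body : Mem → Outcome Unit) : ℕ → Mem → Outcome Unit
  | 0, M => ⟨(), M, 1⟩
  | n + 1, M =>
    let t := test M
    if t.val then
      let s := body t.mem
      let r := runWhile test body n s.mem
      ⟨(), r.mem, t.steps + s.steps + r.steps + 1⟩
    else ⟨(), t.mem, t.steps + 1⟩

/-- Running a program. Every primitive instruction takes one step. -/
def Prog.run : {α : Type} → Prog ℕ α → Mem → Outcome α
  | _, .ret a, M => ⟨a, M, 0⟩
  | _, .andThen p q, M =>
    let r := p.run M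
    let s := (q r.val).run r.mem
    ⟨s.val, s.mem, r.steps + s.steps⟩
  | _, .zero, M => ⟨0, M, 1⟩
  | _, .succ x, M => ⟨x + 1, M, 1⟩
  | _, .eq x y, M => ⟨decide (x = y), M, 1⟩
  | _, .lt x y, M => ⟨decide (x < y), M, 1⟩
  | _, .load A i j, M => ⟨M A i j, M, 1⟩
  | _, .store A i j x, M => ⟨(), M.set A i j x, 1⟩
  | _, .forLoop n body, M => runFor (fun i => (body i).run) n M
  | _, .whileLoop n test body, M => runWhile test.run body.run n M

/-! ## The algorithm -/

section Algorithm

open Prog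

variable {ν : Type}

/-- Read a scalar. -/
def get (A : Arr) : Prog ν ν := do
  let z ← zero
  load A z z

/-- Read entry `i` of a one-dimensional array. -/
def getAt (A : Arr) (i : ν) : Prog ν ν := do
  let z ← zero
  load A i z

/-- Write a scalar. -/
def put (A : Arr) (x : ν) : Prog ν Unit := do
  let z ← zero
  store A z z x

/-- Write entry `i` of a one-dimensional array. -/
def putAt (A : Arr) (i x : ν) : Prog ν Unit := do
  let z ← zero
  store A i z x

/-- The constant `1`. -/
def one : Prog ν ν := do
  let z ← zero
  succ z

/-- Is the flag in cell `(i, j)` of `A` equal to `1`? -/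
def flagged (A : Arr) (i j : ν) : Prog ν Bool := do
  let x ← load A i j
  let o ← one
  eq x o

/-- Set the flag in cell `(i, j)` of `A` to `1`. -/
def setFlag (A : Arr) (i j : ν) : Prog ν Unit := do
  let o ← one
  store A i j o

/-- Increase a scalar by `1`. -/
def increment (A : Arr) : Prog ν Unit := do
  let x ← get A
  let y ← succ x
  put A y

/-- Append `x` to row `r` of the table `A`, whose row lengths are kept in `len`. -/
def pushRow (len A : Arr) (r x : ν) : Prog ν Unit := do
  let t ← getAt len r
  store A r t x
  let t' ← succ t
  putAt len r t'

/-- Build the adjacency matrix from the adjacency lists. -/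
def buildAdj : Prog ν Unit := do
  let n ← get .size
  forLoop n fun v => do
    let d ← getAt .deg v
    forLoop d fun k => do
      let u ← load .nbr v k
      setFlag .adj v u

/-- Decide whether the edges `cp` and `cq`, where `p ≠ q`, fail to span a unique square that is
moreover chordless. -/
def adjacentRelated (c p q : ν) : Prog ν Bool := do
  let pq ← flagged .adj p q
  if pq then return true
  let z ← zero
  put .count z
  put .chord z
  let d ← getAt .deg p
  forLoop d fun k => do
    let x ← load .nbr p k
    let isC ← eq x c
    let xq ← flagged .adj x q
    if xq && !isC then
      increment .count
      let xc ← flagged .adj x c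
      if xc then setFlag .chord z z
  let m ← get .count
  let o ← one
  let unique ← eq m o
  let bad ← flagged .chord z z
  return !(unique && !bad)

/-- Decide whether the disjoint edges `pq` and `ab` are opposite edges of a chordless square. -/
def oppositeRelated (p q a b : ν) : Prog ν Bool := do
  let pa ← flagged .adj p a
  let pb ← flagged .adj p b
  let qa ← flagged .adj q a
  let qb ← flagged .adj q b
  return (pa && qb && !pb && !qa) || (pb && qa && !pa && !qb)

/-- Decide whether the edges `pq` and `ab` are in relation `δ`. -/
def deltaTest (p q a b : ν) : Prog ν Bool := do
  let pa ← eq p a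
  let pb ← eq p b
  let qa ← eq q a
  let qb ← eq q b
  if pa then
    if qb then return true else adjacentRelated p q b
  else if pb then
    if qa then return true else adjacentRelated p q a
  else if qa then adjacentRelated q p b
  else if qb then adjacentRelated q p a
  else oppositeRelated p q a b

/-- For the edges `e_0, …, e_{d-1}` at `v`: set `loc i k` to `1` if there is an edge `f` such that
`e_i` and `e_k` are both in relation `δ` to `f`, and to `0` otherwise. Only edges `f` that are
incident to a neighbour of `v` can occur. -/
def computeLoc (v : ν) : Prog ν Unit := do
  let d ← getAt .deg v
  let z ← zero
  forLoop d fun i =>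
    forLoop d fun k => store .loc i k z
  forLoop d fun j => do
    let a ← load .nbr v j
    let da ← getAt .deg a
    forLoop da fun l => do
      let b ← load .nbr a l
      forLoop d fun i => do
        let u ← load .nbr v i
        let r ← deltaTest v u a b
        if r then setFlag .hit i z else putAt .hit i z
      forLoop d fun i => do
        let hi ← flagged .hit i z
        if hi then
          forLoop d fun k => do
            let hk ← flagged .hit k z
            if hk then setFlag .loc i k

/-- Replace `loc` by its transitive closure. -/
def closeLoc (v : ν) : Prog ν Unit := do
  let d ← getAt .deg v
  forLoop d fun k =>
    forLoop d fun i => do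
      let ik ← flagged .loc i k
      if ik then
        forLoop d fun j => do
          let kj ← flagged .loc k j
          if kj then setFlag .loc i j

/-- Give a new colour, that is, a new vertex of the colour graph, to each local class, and
assign colours to the edges at `v`. -/
def assignColours (v : ν) : Prog ν Unit := do
  let d ← getAt .deg v
  let z ← zero
  forLoop d fun i => do
    put .old z
    forLoop i fun k => do
      let ik ← flagged .loc i k
      if ik then
        let c ← getAt .locCol k
        putAt .locCol i c
        setFlag .old z z
    let o ← flagged .old z z
    if !o then
      increment .numCol
      let c ← get .numCol
      putAt .locCol i c

/-- Put the vertex `x` into the output subgraph, unless it is already there. -/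
def addVertex (x : ν) : Prog ν Unit := do
  let z ← zero
  let s ← flagged .seen x z
  if !s then
    setFlag .seen x z
    let m ← get .vLen
    putAt .vList m x
    increment .vLen

/-- Give the new colour `y` to the edge `ab` of `S_v`. If the edge was already coloured, its old
colour and `y` are joined in the colour graph; otherwise it is put into the output subgraph. -/
def paint (a b y : ν) : Prog ν Unit := do
  let x ← load .col a b
  let z ← zero
  let fresh ← eq x z
  if fresh then
    let m ← get .eLen
    putAt .eFst m a
    putAt .eSnd m b
    increment .eLen
    addVertex a
    addVertex b
  else
    pushRow .gLen .gNbr x y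
    pushRow .gLen .gNbr y x
  store .col a b y
  store .col b a y

/-- Colour the edges of `S_v`: the edges at `v`, and the edges opposite to them in the squares
spanned by edges at `v` of different local classes. -/
def colourPSP (v : ν) : Prog ν Unit := do
  let d ← getAt .deg v
  forLoop d fun i => do
    let u ← load .nbr v i
    let c ← getAt .locCol i
    paint v u c
  forLoop d fun i => do
    let u ← load .nbr v i
    let du ← getAt .deg u
    forLoop d fun k => do
      let ik ← flagged .loc i k
      if !ik then
        let w ← load .nbr v k
        let c ← getAt .locCol k
        forLoop du fun l => do
          let x ← load .nbr u l
          let isV ← eq x v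
          let xw ← flagged .adj x w
          if xw && !isV then paint u x c

/-- Visit the colour `c`: label it with the current component and put it into the queue. -/
def visit (c : ν) : Prog ν Unit := do
  let k ← get .numComp
  putAt .comp c k
  let t ← get .qTail
  putAt .queue t c
  increment .qTail

/-- Compute the connected components of the colour graph by breadth-first search. -/
def components : Prog ν Unit := do
  let n ← get .numCol
  let z ← zero
  forLoop n fun i => do
    let c ← succ i
    let k ← getAt .comp c
    let new ← eq k z
    if new then
      increment .numComp
      visit c
      whileLoop n
        (do
          let h ← get .qHead
          let t ← get .qTail
          lt h t)
        (do
          let h ← get .qHead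
          let x ← getAt .queue h
          increment .qHead
          let g ← getAt .gLen x
          forLoop g fun j => do
            let y ← load .gNbr x j
            let k' ← getAt .comp y
            let new' ← eq k' z
            if new' then visit y)

/-- Put every edge into the class given by the component of its colour. -/
def collectClasses : Prog ν Unit := do
  let m ← get .eLen
  forLoop m fun i => do
    let a ← getAt .eFst i
    let b ← getAt .eSnd i
    let c ← load .col a b
    let k ← getAt .comp c
    pushRow .clsLen .cls k i

/-- The colour-graph algorithm: scan the vertices of `W`, colour the edges of each partial star
product by the classes of its local relation, join colours that meet on an edge, and read off the
global classes from the connected components of the colour graph. -/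
def localRW : Prog ν Unit := do
  buildAdj
  let w ← get .wLen
  forLoop w fun s => do
    let v ← getAt .wList s
    computeLoc v
    closeLoc v
    assignColours v
    colourPSP v
  components
  collectClasses

end Algorithm

/-! ## Input and output conventions -/

section Encoding

variable {V : Type*} {n : ℕ}

/-- The natural number that stands for the vertex `v`. -/
def code (num : V ≃ Fin n) (v : V) : ℕ := (num v : ℕ)

/-- The memory `M` holds the graph `G` (as adjacency lists in any order) and the set `W` (as a
list in any order), and all cells outside the input arrays are `0`. -/
structure IsInput [Fintype V] (G : SimpleGraph V) [DecidableRel G.Adj] (W : Finset V)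
    (num : V ≃ Fin n) (M : Mem) : Prop where
  size : M .size 0 0 = n
  deg : ∀ v, M .deg (code num v) 0 = G.degree v
  nbr : ∀ v, Set.BijOn (fun k => M .nbr (code num v) k) (Set.Iio (G.degree v))
    (code num '' G.neighborSet v)
  wLen : M .wLen 0 0 = W.card
  wList : Set.BijOn (fun k => M .wList k 0) (Set.Iio W.card) (code num '' (W : Set V))
  blank : ∀ A i j, A ≠ .size → A ≠ .deg → A ≠ .nbr → A ≠ .wLen → A ≠ .wList → M A i j = 0

/-- The `i`-th edge of the output subgraph. -/
def outEdge (M : Mem) (i : ℕ) : Sym2 ℕ := s(M .eFst i 0, M .eSnd i 0)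

/-- The `k`-th class of the output. -/
def outClass (M : Mem) (k : ℕ) : Set (Sym2 ℕ) :=
  {e | ∃ t < M .clsLen k 0, e = outEdge M (M .cls k t)}

/-- The memory `M` holds the subgraph `⋃_{v ∈ W} S_v` (its vertices and its edges, listed without
repetition) and the classes of `𝔡_{|S_v}(W)^*` (as edge lists numbered `1, …, numComp`, each
class occurring exactly once). -/
structure IsOutput (G : SimpleGraph V) (W : Finset V) (num : V ≃ Fin n) (M : Mem) : Prop where
  verts : Set.BijOn (fun i => M .vList i 0) (Set.Iio (M .vLen 0 0))
    (code num '' (pspUnion G (W : Set V)).verts)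
  edges : Set.BijOn (outEdge M) (Set.Iio (M .eLen 0 0))
    (Sym2.map (code num) '' (pspUnion G (W : Set V)).edgeSet)
  classes : Set.BijOn (outClass M) (Set.Icc 1 (M .numComp 0 0))
    ((fun φ => Sym2.map (code num) '' φ) '' pspClasses G (W : Set V))

end Encoding

end PSP

/-! The classes are transitive closures on two levels, local and global. Throughout, D ≥ 1 is an
upper bound for the degrees.

Local level. Every pair in 𝔡_v has a member in E_v, so a 𝔡_v-chain between two edges at v meets E_v
at least at every second edge. Hence on E_v the relation 𝔡_v^* is the transitive closure of "having
a common δ-partner", and such a partner is incident to a neighbour of v (`exists_mem_of_delta`,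
`transGen_posRel_iff`). This leaves at most D² candidate partners, each compared with at most D
edges at v by a test of cost O(D), which gives the fourth power; Warshall's closure afterwards costs
O(D³). If two edges at v are not in 𝔡_v^*, they are not in δ, so they span exactly one square and it
is chordless. Any common neighbour of their far ends other than v is then its fourth vertex
(`isChordlessSquare_of_not_localRelStar`), so F_v is found without testing chords. Each edge of F_v
is opposite to an edge at v, hence related to it and entitled to its colour. Sharing a colour is
therefore exactly 𝔡_{|S_v} (`exists_ownEdge_iff_pspRel`).

Global level. Only the latest colour of an edge is stored. The invariant `Painted` records that
every colour an edge has ever received is connected in the colour graph to the stored one, and that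
joined colours have met on some edge. Colours of different scanned vertices are distinct, so sharing
a colour at some time means being related by 𝔡_{|S_v} for some v in W (`Colouring`). Together these
identify the components of the colour graph with the classes of the transitive closure
(`reflTransGen_joined_iff`).

Time. A scanned vertex creates at most D colours and causes at most 2D³ paint operations, each of
which adds at most two entries to the adjacency lists of the colour graph. Breadth-first search is
linear in the size of that graph by amortisation (`components_spec`). Zero-initialised memory makes
it unnecessary to clear the adjacency matrix and the colour table, so no term quadratic in the
number of vertices occurs. -/

namespace PSP

/-! ## Program logic -/

/-- `wp p M s Q`: running `p` from memory `M`, after `s` steps already made, ends with a value,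
a memory and a total number of steps that satisfy `Q`. -/
def wp {α : Type} (p : Prog ℕ α) (M : Mem) (s : ℕ) (Q : α → Mem → ℕ → Prop) : Prop :=
  Q (p.run M).val (p.run M).mem (s + (p.run M).steps)

section Wp

variable {α β : Type} {M : Mem} {s : ℕ}

-- Together with the equations that follow, this lets `simp` execute straight-line code symbolically
-- and count its steps exactly. Only loops and subroutines need a separate argument.
@[simp] theorem wp_pure (a : α) (Q : α → Mem → ℕ → Prop) :
    wp (pure a : Prog ℕ α) M s Q ↔ Q a M s := Iff.rfl

@[simp] theorem wp_bind (p : Prog ℕ α) (q : α → Prog ℕ β) (Q : β → Mem → ℕ → Prop) :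
    wp (p >>= q) M s Q ↔ wp p M s fun a M' s' => wp (q a) M' s' Q := by
  simp only [wp, add_assoc]
  rfl

@[simp] theorem wp_zero (Q : ℕ → Mem → ℕ → Prop) : wp .zero M s Q ↔ Q 0 M (s + 1) := Iff.rfl

@[simp] theorem wp_succ (x : ℕ) (Q : ℕ → Mem → ℕ → Prop) :
    wp (.succ x) M s Q ↔ Q (x + 1) M (s + 1) := Iff.rfl

@[simp] theorem wp_eq (x y : ℕ) (Q : Bool → Mem → ℕ → Prop) :
    wp (.eq x y) M s Q ↔ Q (decide (x = y)) M (s + 1) := Iff.rfl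

@[simp] theorem wp_load (A : Arr) (i j : ℕ) (Q : ℕ → Mem → ℕ → Prop) :
    wp (.load A i j) M s Q ↔ Q (M A i j) M (s + 1) := Iff.rfl

@[simp] theorem wp_store (A : Arr) (i j x : ℕ) (Q : Unit → Mem → ℕ → Prop) :
    wp (.store A i j x) M s Q ↔ Q () (M.set A i j x) (s + 1) := Iff.rfl

@[simp] theorem wp_ite {c : Prop} [Decidable c] (p q : Prog ℕ α) (Q : α → Mem → ℕ → Prop) :
    wp (if c then p else q) M s Q ↔ if c then wp p M s Q else wp q M s Q := by
  split <;> rfl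

@[simp] theorem wp_get (A : Arr) (Q : ℕ → Mem → ℕ → Prop) :
    wp (get A) M s Q ↔ Q (M A 0 0) M (s + 2) := by simp [get]

@[simp] theorem wp_getAt (A : Arr) (i : ℕ) (Q : ℕ → Mem → ℕ → Prop) :
    wp (getAt A i) M s Q ↔ Q (M A i 0) M (s + 2) := by simp [getAt]

@[simp] theorem wp_put (A : Arr) (x : ℕ) (Q : Unit → Mem → ℕ → Prop) :
    wp (put A x) M s Q ↔ Q () (M.set A 0 0 x) (s + 2) := by simp [put]

@[simp] theorem wp_putAt (A : Arr) (i x : ℕ) (Q : Unit → Mem → ℕ → Prop) :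
    wp (putAt A i x) M s Q ↔ Q () (M.set A i 0 x) (s + 2) := by simp [putAt]

@[simp] theorem wp_one (Q : ℕ → Mem → ℕ → Prop) :
    wp one M s Q ↔ Q 1 M (s + 2) := by simp [one]

@[simp] theorem wp_flagged (A : Arr) (i j : ℕ) (Q : Bool → Mem → ℕ → Prop) :
    wp (flagged A i j) M s Q ↔ Q (decide (M A i j = 1)) M (s + 4) := by simp [flagged, add_assoc]

@[simp] theorem wp_setFlag (A : Arr) (i j : ℕ) (Q : Unit → Mem → ℕ → Prop) :
    wp (setFlag A i j) M s Q ↔ Q () (M.set A i j 1) (s + 3) := by simp [setFlag, add_assoc]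

@[simp] theorem wp_increment (A : Arr) (Q : Unit → Mem → ℕ → Prop) :
    wp (increment A) M s Q ↔ Q () (M.set A 0 0 (M A 0 0 + 1)) (s + 5) := by
  simp [increment, add_assoc]

@[simp] theorem wp_pushRow (len A : Arr) (r x : ℕ) (Q : Unit → Mem → ℕ → Prop) :
    wp (pushRow len A r x) M s Q ↔
      Q () ((M.set A r (M len r 0) x).set len r 0 (M len r 0 + 1)) (s + 6) := by
  simp [pushRow, add_assoc]

/-- `Spec p M t Q`: running `p` from memory `M` takes at most `t` steps and establishes `Q`. -/
def Spec (p : Prog ℕ α) (M : Mem) (t : ℕ) (Q : α → Mem → Prop) : Prop :=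
  wp p M 0 fun a M' s' => Q a M' ∧ s' ≤ t

/-- A subroutine is analysed once, with the clock starting at 0 and an upper bound on its time; this
rule moves the result to any starting time and weakens the postcondition. -/
theorem Spec.wp {p : Prog ℕ α} {t : ℕ} {Q : α → Mem → Prop} {R : α → Mem → ℕ → Prop}
    (h : Spec p M t Q) (hR : ∀ a M' s', Q a M' → s' ≤ s + t → R a M' s') : wp p M s R :=
  hR _ _ _ h.1 (by have := h.2; omega)

theorem wp_forLoop {n : ℕ} {body : ℕ → Prog ℕ Unit} {R : Unit → Mem → ℕ → Prop}
    (I : ℕ → Mem → Prop) (t : ℕ) (h0 : I 0 M)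
    (hstep : ∀ i < n, ∀ M', I i M' → Spec (body i) M' t fun _ => I (i + 1))
    (hR : ∀ M' s', I n M' → s' ≤ s + (n * (t + 1) + 1) → R () M' s') :
    wp (.forLoop n body) M s R := by
  have key : ∀ k ≤ n, I k (runFor (fun i => (body i).run) k M).mem ∧
      (runFor (fun i => (body i).run) k M).steps ≤ k * (t + 1) + 1 := by
    intro k hk
    induction k with
    | zero => exact ⟨h0, by simp [runFor]⟩
    | succ k ih =>
      obtain ⟨h1, h2⟩ := ih (by omega)
      obtain ⟨h3, h4⟩ := hstep k (by omega) _ h1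
      refine ⟨h3, ?_⟩
      simp only [runFor]
      rw [Nat.zero_add] at h4
      rw [Nat.succ_mul]
      omega
  obtain ⟨h1, h2⟩ := key n le_rfl
  exact hR _ _ h1 (Nat.add_le_add_left h2 s)

/-- The rule for loops whose total running time is amortised: the invariant mentions the number
of steps made since the start of the loop. -/
theorem wp_forLoop_amortised {n : ℕ} {body : ℕ → Prog ℕ Unit} {R : Unit → Mem → ℕ → Prop}
    (I : ℕ → Mem → ℕ → Prop) (h0 : I 0 M 0)
    (hstep : ∀ i < n, ∀ M' s', I i M' s' →
      wp (body i) M' s' fun _ M'' s'' => I (i + 1) M'' (s'' + 1))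
    (hR : ∀ M' s', I n M' s' → R () M' (s + (s' + 1))) :
    wp (.forLoop n body) M s R := by
  have key : ∀ k ≤ n, ∃ t, (runFor (fun i => (body i).run) k M).steps = t + 1 ∧
      I k (runFor (fun i => (body i).run) k M).mem t := by
    intro k hk
    induction k with
    | zero => exact ⟨0, rfl, h0⟩
    | succ k ih =>
      obtain ⟨t, h1, h2⟩ := ih (by omega)
      have h3 := hstep k (by omega) _ _ h2
      refine ⟨_, ?_, h3⟩
      simp only [runFor, h1]
      omega
  obtain ⟨t, h1, h2⟩ := key n le_rfl
  have h3 := hR _ _ h2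
  rw [← h1] at h3
  exact h3

/-- The rule for bounded `while` loops with a measure that bounds the number of rounds. The
invariant mentions the number of steps made since the start of the loop. -/
theorem wp_whileLoop {n : ℕ} {test : Prog ℕ Bool} {body : Prog ℕ Unit}
    {R : Unit → Mem → ℕ → Prop} (I : Mem → ℕ → Prop) (μ : Mem → ℕ) (g : Mem → Bool) (t₀ : ℕ)
    (htest : ∀ M', test.run M' = ⟨g M', M', t₀⟩) (h0 : I M 0) (hμ : μ M ≤ n)
    (hstep : ∀ M' s', I M' s' → g M' = true →
      wp body M' (s' + t₀) fun _ M'' s'' => I M'' (s'' + 1) ∧ μ M'' < μ M')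
    (hR : ∀ M' s' s'', I M' s' → g M' = false → s'' ≤ s + (s' + t₀ + 1) → R () M' s'') :
    wp (.whileLoop n test body) M s R := by
  have key : ∀ n M r, I M r → μ M ≤ n → ∃ M' s', I M' s' ∧ g M' = false ∧
      (runWhile test.run body.run n M).mem = M' ∧
      r + (runWhile test.run body.run n M).steps ≤ s' + t₀ + 1 := by
    intro n
    induction n with
    | zero =>
      intro M r hI hn
      refine ⟨M, r, hI, ?_, rfl, by simp only [runWhile]; omega⟩
      -- When no rounds are left the measure is 0, and a successful test would push it below 0. So
      -- the cap on the number of rounds never cuts the loop short.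
      by_contra hg
      have := (hstep M r hI (by simpa using hg)).2
      omega
    | succ n ih =>
      intro M r hI hn
      by_cases hb : g M = true
      · obtain ⟨h2, h3⟩ := hstep M r hI hb
        obtain ⟨M', s', h4, h5, h6, h7⟩ := ih _ _ h2 (by omega)
        refine ⟨M', s', h4, h5, ?_, ?_⟩
        · simp only [runWhile, htest, hb, if_true]; exact h6
        · simp only [runWhile, htest, hb, if_true]; omega
      · refine ⟨M, r, hI, by simpa using hb, ?_, ?_⟩
        · simp only [runWhile, htest, hb]; rfl
        · simp only [runWhile, htest, hb]
          change r + (t₀ + 1) ≤ _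
          omega
  obtain ⟨M', s', h1, h2, h3, h4⟩ := key n M 0 h0 hμ
  have := hR M' s' (s + (runWhile test.run body.run n M).steps) h1 h2 (by omega)
  rw [← h3] at this
  exact this

end Wp

/-! ## Memory -/

theorem Mem.set_self (M : Mem) (A : Arr) (i j x k l : ℕ) :
    M.set A i j x A k l = if k = i ∧ l = j then x else M A k l := by
  simp [Mem.set]

theorem Mem.set_of_ne (M : Mem) {A B : Arr} (h : B ≠ A) (i j x : ℕ) : M.set A i j x B = M B := by
  funext k l
  simp [Mem.set, h]

/-- `M` and `M'` differ only in arrays from the list `S`. -/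
def Frame (S : List Arr) (M M' : Mem) : Prop := ∀ A, A ∉ S → M' A = M A

theorem Frame.refl (S : List Arr) (M : Mem) : Frame S M M := fun _ _ => rfl

theorem Frame.trans {S : List Arr} {M M' M'' : Mem} (h : Frame S M M') (h' : Frame S M' M'') :
    Frame S M M'' := fun A hA => (h' A hA).trans (h A hA)

theorem Frame.mono {S T : List Arr} {M M' : Mem} (h : Frame S M M') (hST : S ⊆ T) :
    Frame T M M' := fun A hA => h A fun hS => hA (hST hS)

theorem Frame.set {S : List Arr} {M M' : Mem} (h : Frame S M M') {A : Arr} (hA : A ∈ S)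
    (i j x : ℕ) : Frame S M (M'.set A i j x) := fun B hB => by
  have hne : B ≠ A := by rintro rfl; exact hB hA
  rw [Mem.set_of_ne _ hne, h B hB]

/-! ## The relation `δ` and the local relations -/

section Graph

variable {V : Type*} {G : SimpleGraph V}

theorem IsSquare.reverse {a b c d : V} (h : IsSquare G a b c d) : IsSquare G a d c b :=
  ⟨h.2.2.2.1.symm, h.2.2.1.symm, h.2.1.symm, h.1.symm, h.2.2.2.2.1, h.2.2.2.2.2.symm⟩

theorem IsChordlessSquare.reverse {a b c d : V} (h : IsChordlessSquare G a b c d) :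
    IsChordlessSquare G a d c b := ⟨h.1.reverse, h.2.1, fun hh => h.2.2 hh.symm⟩

theorem SpanUniqueChordlessSquare.swap {v u w : V} (h : SpanUniqueChordlessSquare G v u w) :
    SpanUniqueChordlessSquare G v w u :=
  let ⟨x, hx, hu⟩ := h
  ⟨x, hx.reverse, fun y hy => hu y hy.reverse⟩

theorem delta_symm {e f : Sym2 V} (h : delta G e f) : delta G f e := by
  obtain ⟨he, hf, h⟩ := h
  refine ⟨hf, he, ?_⟩
  rcases h with ⟨v, u, w, huw, rfl, rfl, h⟩ | ⟨a, b, c, d, h, rfl, rfl⟩ | rfl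
  · exact .inl ⟨v, w, u, huw.symm, rfl, rfl, fun hh => h hh.swap⟩
  · refine .inr (.inl ⟨c, d, a, b, ⟨⟨h.1.2.2.1, h.1.2.2.2.1, h.1.1, h.1.2.1, h.1.2.2.2.2.1.symm,
      h.1.2.2.2.2.2.symm⟩, fun hh => h.2.1 hh.symm, fun hh => h.2.2 hh.symm⟩, rfl, rfl⟩)
  · exact .inr (.inr rfl)

theorem delta_refl {e : Sym2 V} (he : e ∈ G.edgeSet) : delta G e e :=
  ⟨he, he, .inr (.inr rfl)⟩

theorem delta_of_opposite {a b c d : V} (h : IsChordlessSquare G a b c d) :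
    delta G s(a, b) s(c, d) :=
  ⟨h.1.1, h.1.2.2.1, .inr (.inl ⟨a, b, c, d, h, rfl, rfl⟩)⟩

/-- Two distinct adjacent edges share exactly one vertex, so they can be neither equal nor opposite
in a square, and their common vertex and far ends are determined. -/
theorem delta_adjacent_iff {v u w : V} (hu : G.Adj v u) (hw : G.Adj v w) (huw : u ≠ w) :
    delta G s(v, u) s(v, w) ↔ ¬ SpanUniqueChordlessSquare G v u w := by
  refine ⟨fun h => ?_, fun h => ⟨hu, hw, .inl ⟨v, u, w, huw, rfl, rfl, h⟩⟩⟩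
  obtain ⟨-, -, ⟨v', u', w', h1, h2, h3, h4⟩ | ⟨a, b, c, d, h1, h2, h3⟩ | h1⟩ := h
  · rw [Sym2.eq_iff] at h2 h3
    have := hu.ne
    have := hw.ne
    grind
  · rw [Sym2.eq_iff] at h2 h3
    obtain ⟨⟨h4, h5, h6, h7, h8, h9⟩, -⟩ := h1
    have := h5.ne
    have := h7.ne
    rcases h2 with ⟨rfl, rfl⟩ | ⟨rfl, rfl⟩ <;> rcases h3 with ⟨rfl, rfl⟩ | ⟨rfl, rfl⟩ <;> tauto
  · rw [Sym2.eq_iff] at h1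
    have := hw.ne
    tauto

/-- Disjoint edges can be related only as opposite edges of a square, and there are just two ways to
join their ends; the two remaining pairs are the diagonals. -/
theorem delta_disjoint_iff {p q a b : V} (hpq : G.Adj p q) (hab : G.Adj a b) (hpa : p ≠ a)
    (hpb : p ≠ b) (hqa : q ≠ a) (hqb : q ≠ b) :
    delta G s(p, q) s(a, b) ↔
      (G.Adj p a ∧ G.Adj q b ∧ ¬ G.Adj p b ∧ ¬ G.Adj q a) ∨
        (G.Adj p b ∧ G.Adj q a ∧ ¬ G.Adj p a ∧ ¬ G.Adj q b) := by
  constructor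
  · rintro ⟨-, -, ⟨v', u', w', h1, h2, h3, h4⟩ | ⟨a', b', c, d, h1, h2, h3⟩ | h1⟩
    · exfalso
      rw [Sym2.eq_iff] at h2 h3
      rcases h2 with ⟨rfl, rfl⟩ | ⟨rfl, rfl⟩ <;> rcases h3 with ⟨rfl, rfl⟩ | ⟨rfl, rfl⟩ <;> tauto
    · rw [Sym2.eq_iff] at h2 h3
      obtain ⟨⟨h4, h5, h6, h7, h8, h9⟩, h10, h11⟩ := h1
      have h5' := h5.symm
      have h7' := h7.symm
      rcases h2 with ⟨rfl, rfl⟩ | ⟨rfl, rfl⟩ <;> rcases h3 with ⟨rfl, rfl⟩ | ⟨rfl, rfl⟩ <;> tauto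
    · exfalso
      rw [Sym2.eq_iff] at h1
      tauto
  · rintro (⟨h1, h2, h3, h4⟩ | ⟨h1, h2, h3, h4⟩)
    · have : IsChordlessSquare G p q b a := ⟨⟨hpq, h2, hab.symm, h1.symm, hpb, hqa⟩, h3, h4⟩
      have := delta_of_opposite this
      rwa [Sym2.eq_swap (a := b)] at this
    · exact delta_of_opposite ⟨⟨hpq, h2, hab, h1.symm, hpa, hqb⟩, h3, h4⟩

theorem localRel_symm {v : V} {e f : Sym2 V} (h : localRel G v e f) : localRel G v f e :=
  ⟨h.1.symm, delta_symm h.2⟩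

theorem localRelStar_symm {v : V} {e f : Sym2 V} (h : localRelStar G v e f) :
    localRelStar G v f e := by
  induction h with
  | single h => exact .single (localRel_symm h)
  | tail _ h ih => exact .head (localRel_symm h) ih

theorem localRelStar_trans {v : V} {e f g : Sym2 V} (h : localRelStar G v e f)
    (h' : localRelStar G v f g) : localRelStar G v e g := Relation.TransGen.trans h h'

theorem localRelStar_refl {v u : V} (h : G.Adj v u) : localRelStar G v s(v, u) s(v, u) :=
  .single ⟨.inl ⟨h, Sym2.mem_mk_left _ _⟩, delta_refl h⟩

/-- In each clause of δ the second edge has an end adjacent to v. This confines the search for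
common partners to edges at neighbours of v. -/
theorem exists_mem_of_delta {v u : V} {g : Sym2 V} (h : delta G s(v, u) g) :
    ∃ a b, G.Adj v a ∧ G.Adj a b ∧ g = s(a, b) := by
  obtain ⟨h1, h2, ⟨v', u', w, -, h3, rfl, -⟩ | ⟨a, b, c, d, h3, h4, rfl⟩ | rfl⟩ := h
  · rw [Sym2.eq_iff] at h3
    rcases h3 with ⟨rfl, rfl⟩ | ⟨rfl, rfl⟩
    · exact ⟨w, v, h2, h2.symm, Sym2.eq_swap⟩
    · exact ⟨u, w, h1, h2, rfl⟩
  · rw [Sym2.eq_iff] at h4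
    obtain ⟨⟨-, h5, h6, h7, -⟩, -⟩ := h3
    rcases h4 with ⟨rfl, rfl⟩ | ⟨rfl, rfl⟩
    · exact ⟨d, c, h7.symm, h6.symm, Sym2.eq_swap⟩
    · exact ⟨c, d, h5, h6, rfl⟩
  · exact ⟨u, v, h1, G.adj_symm h1, Sym2.eq_swap⟩

/-- Two edges at `v` are both related to some edge that is incident to a neighbour of `v`. -/
def CommonDelta (G : SimpleGraph V) (v : V) (e f : Sym2 V) : Prop :=
  ∃ a b, G.Adj v a ∧ G.Adj a b ∧ delta G e s(a, b) ∧ delta G f s(a, b)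

theorem CommonDelta.of_delta {v u : V} {f g : Sym2 V} (h : delta G s(v, u) g)
    (h' : delta G f g) : CommonDelta G v s(v, u) f := by
  obtain ⟨a, b, h1, h2, rfl⟩ := exists_mem_of_delta h
  exact ⟨a, b, h1, h2, h, h'⟩

/-- The relation on the positions of the edges `s(v, nb i)` at `v` that generates `𝔡_v^*`. -/
def posRel (G : SimpleGraph V) (v : V) (nb : ℕ → V) (d i k : ℕ) : Prop :=
  i < d ∧ k < d ∧ CommonDelta G v s(v, nb i) s(v, nb k)

theorem exists_pos {v : V} {nb : ℕ → V} {d : ℕ}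
    (hnb : Set.BijOn nb (Set.Iio d) (G.neighborSet v)) {u : V} (h : G.Adj v u) :
    ∃ i < d, nb i = u := hnb.surjOn h

theorem exists_pos_edge {v : V} {nb : ℕ → V} {d : ℕ}
    (hnb : Set.BijOn nb (Set.Iio d) (G.neighborSet v)) {e : Sym2 V} (h : e ∈ G.incidenceSet v) :
    ∃ i < d, e = s(v, nb i) := by
  obtain ⟨u, rfl⟩ := h.2
  obtain ⟨i, hi, rfl⟩ := exists_pos hnb h.1
  exact ⟨i, hi, rfl⟩

/-- A 𝔡_v-chain may leave E_v, but never for two consecutive edges, so an excursion is a single edge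
that is a δ-partner of both its neighbours in the chain. A step inside E_v is of this kind too,
because δ is reflexive on edges. -/
theorem transGen_posRel_iff {v : V} {nb : ℕ → V} {d : ℕ}
    (hnb : Set.BijOn nb (Set.Iio d) (G.neighborSet v)) {i k : ℕ} (hi : i < d) (hk : k < d) :
    Relation.TransGen (posRel G v nb d) i k ↔ localRelStar G v s(v, nb i) s(v, nb k) := by
  have hadj : ∀ j < d, G.Adj v (nb j) := fun j hj => hnb.mapsTo hj
  constructor
  · have step : ∀ i k, posRel G v nb d i k → localRelStar G v s(v, nb i) s(v, nb k) := by
      rintro i k ⟨hi, hk, a, b, -, -, h1, h2⟩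
      exact .tail (.single ⟨.inl ⟨hadj _ hi, Sym2.mem_mk_left _ _⟩, h1⟩)
        ⟨.inr ⟨hadj _ hk, Sym2.mem_mk_left _ _⟩, delta_symm h2⟩
    intro h
    induction h with
    | single h => exact step _ _ h
    | tail _ h ih => exact localRelStar_trans (ih h.1) (step _ _ h)
  -- The end of the chain is generalised to an arbitrary edge g, since the induction passes through
  -- edges outside E_v: every position whose edge is a δ-partner of g is reachable.
  · have key : ∀ g, localRelStar G v s(v, nb i) g → ∀ k < d, delta G s(v, nb k) g →
        Relation.TransGen (posRel G v nb d) i k := by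
      intro g hg
      induction hg with
      | single h => exact fun k hk h' => .single ⟨hi, hk, .of_delta h.2 h'⟩
      | @tail g g' _ h ih =>
        intro k hk h'
        -- If g lies in E_v, its position is reachable and g' is the common partner with `k`. If g'
        -- lies in E_v, its position is reachable because g' is a partner of g, and g' itself is the
        -- common partner with `k`.
        rcases h.1 with hv | hv
        · obtain ⟨m, hm, rfl⟩ := exists_pos_edge hnb hv
          exact (ih m hm (delta_refl (hadj m hm))).tail ⟨hm, hk, .of_delta h.2 h'⟩
        · obtain ⟨m, hm, rfl⟩ := exists_pos_edge hnb hv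
          exact (ih m hm (delta_symm h.2)).tail
            ⟨hm, hk, .of_delta (delta_refl (hadj m hm)) h'⟩
    exact fun h => key _ h k hk (delta_refl (hadj k hk))

/-! ## Edges of a partial star product and their colours -/

theorem psp_edgeSet (v : V) : (psp G v).edgeSet = pspEdges G v := by
  ext e
  induction e with | _ x y => rfl

theorem mem_pspUnion_edgeSet {W : Set V} {e : Sym2 V} :
    e ∈ (pspUnion G W).edgeSet ↔ ∃ v ∈ W, e ∈ pspEdges G v := by
  simp [pspUnion, SimpleGraph.Subgraph.edgeSet_iSup, psp_edgeSet]

theorem mem_pspUnion_verts {W : Set V} {x : V} :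
    x ∈ (pspUnion G W).verts ↔ ∃ e ∈ (pspUnion G W).edgeSet, x ∈ e := by
  have : x ∈ (pspUnion G W).verts ↔ ∃ v ∈ W, ∃ e ∈ pspEdges G v, x ∈ e := by
    simp [pspUnion, SimpleGraph.Subgraph.verts_iSup, psp]
  rw [this]
  constructor
  · rintro ⟨v, hv, e, he, hx⟩
    exact ⟨e, mem_pspUnion_edgeSet.2 ⟨v, hv, he⟩, hx⟩
  · rintro ⟨e, he, hx⟩
    obtain ⟨v, hv, he⟩ := mem_pspUnion_edgeSet.1 he
    exact ⟨v, hv, e, he, hx⟩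

/-- The edges of `S_v` that get the colour of the `i`-th edge at `v`. -/
def OwnEdge (G : SimpleGraph V) (v : V) (nb : ℕ → V) (d i : ℕ) (e : Sym2 V) : Prop :=
  e = s(v, nb i) ∨ ∃ k < d, ¬ localRelStar G v s(v, nb k) s(v, nb i) ∧
    ∃ x, G.Adj (nb k) x ∧ G.Adj x (nb i) ∧ x ≠ v ∧ e = s(nb k, x)

/-- Unrelated edges at v are in particular not in δ, so their square is unique and chordless; the
given x completes a square and must be its fourth vertex. This is why `colourPSP` tests no chords.
-/
theorem isChordlessSquare_of_not_localRelStar {v u w x : V} (hu : G.Adj v u) (hw : G.Adj v w)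
    (h : ¬ localRelStar G v s(v, u) s(v, w)) (hux : G.Adj u x) (hxw : G.Adj x w) (hx : x ≠ v) :
    IsChordlessSquare G v u x w := by
  have huw : u ≠ w := by
    rintro rfl
    exact h (localRelStar_refl hu)
  have hs : SpanUniqueChordlessSquare G v u w := by
    by_contra hn
    exact h (.single ⟨.inl ⟨hu, Sym2.mem_mk_left _ _⟩, (delta_adjacent_iff hu hw huw).2 hn⟩)
  obtain ⟨y, hy, huniq⟩ := hs
  have : x = y := huniq x ⟨hu, hux, hxw, hw.symm, hx.symm, huw⟩
  exact this ▸ hy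

theorem IsChordlessSquare.localRelStar {v u x w : V} (h : IsChordlessSquare G v u x w) :
    localRelStar G v s(v, w) s(u, x) := by
  have := delta_of_opposite h.reverse
  rw [Sym2.eq_swap (a := x)] at this
  exact .single ⟨.inl ⟨h.reverse.1.1, Sym2.mem_mk_left _ _⟩, this⟩

section Own

variable {v : V} {nb : ℕ → V} {d : ℕ}

theorem OwnEdge.mem
    (hnb : Set.BijOn nb (Set.Iio d) (G.neighborSet v)) {i : ℕ} (hi : i < d) {e : Sym2 V} (h : OwnEdge G v nb d i e) :
    e ∈ pspEdges G v ∧ localRelStar G v s(v, nb i) e := by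
  have hadj : ∀ j < d, G.Adj v (nb j) := fun j hj => hnb.mapsTo hj
  rcases h with rfl | ⟨k, hk, hn, x, h1, h2, h3, rfl⟩
  · exact ⟨.inl ⟨hadj i hi, Sym2.mem_mk_left _ _⟩, localRelStar_refl (hadj i hi)⟩
  · have hs := isChordlessSquare_of_not_localRelStar (hadj k hk) (hadj i hi) hn h1 h2 h3
    exact ⟨.inr ⟨_, _, _, hs, hn, .inl rfl⟩, hs.localRelStar⟩

theorem exists_ownEdge
    (hnb : Set.BijOn nb (Set.Iio d) (G.neighborSet v)) {e : Sym2 V} (h : e ∈ pspEdges G v) :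
    ∃ i < d, OwnEdge G v nb d i e := by
  have key : ∀ u x w, IsChordlessSquare G v u x w → ¬ localRelStar G v s(v, u) s(v, w) →
      ∃ i < d, OwnEdge G v nb d i s(u, x) := by
    intro u x w hs hn
    obtain ⟨k, hk, rfl⟩ := exists_pos hnb hs.1.1
    obtain ⟨i, hi, rfl⟩ := exists_pos hnb hs.reverse.1.1
    exact ⟨i, hi, .inr ⟨k, hk, hn, x, hs.1.2.1, hs.1.2.2.1, hs.1.2.2.2.2.1.symm, rfl⟩⟩
  rcases h with h | ⟨u, x, w, hs, hn, rfl | rfl⟩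
  · obtain ⟨i, hi, rfl⟩ := exists_pos_edge hnb h
    exact ⟨i, hi, .inl rfl⟩
  · exact key u x w hs hn
  · exact key w x u hs.reverse fun h => hn (localRelStar_symm h)

/-- Giving one colour to each local class yields the relation `𝔡_{|S_v}` on coloured edges. -/
theorem exists_ownEdge_iff_pspRel
    (hnb : Set.BijOn nb (Set.Iio d) (G.neighborSet v)) {c : ℕ → ℕ}
    (hc : ∀ i < d, ∀ k < d, c i = c k ↔ localRelStar G v s(v, nb i) s(v, nb k)) (e f : Sym2 V) :
    (∃ x, (∃ i < d, x = c i ∧ OwnEdge G v nb d i e) ∧ ∃ i < d, x = c i ∧ OwnEdge G v nb d i f) ↔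
      pspRel G v e f := by
  rw [pspRel, psp_edgeSet]
  constructor
  · rintro ⟨x, ⟨i, hi, rfl, he⟩, ⟨k, hk, hik, hf⟩⟩
    have he := he.mem hnb hi
    have hf := hf.mem hnb hk
    exact ⟨localRelStar_trans (localRelStar_symm he.2)
      (localRelStar_trans ((hc i hi k hk).1 hik) hf.2), he.1, hf.1⟩
  · rintro ⟨hef, he, hf⟩
    obtain ⟨i, hi, he⟩ := exists_ownEdge hnb he
    obtain ⟨k, hk, hf⟩ := exists_ownEdge hnb hf
    refine ⟨_, ⟨i, hi, rfl, he⟩, ⟨k, hk, ?_, hf⟩⟩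
    exact (hc i hi k hk).2 (localRelStar_trans (he.mem hnb hi).2
      (localRelStar_trans hef (localRelStar_symm (hf.mem hnb hk).2)))

/-- Every edge of S_v is related to the edge at v whose colour it takes, and back. Reflexivity makes
the coloured edges coincide with the edges of the union. -/
theorem pspRel_self (hnb : Set.BijOn nb (Set.Iio d) (G.neighborSet v))
    {e : Sym2 V} (he : e ∈ pspEdges G v) : pspRel G v e e := by
  obtain ⟨i, hi, h⟩ := exists_ownEdge hnb he
  have h := (h.mem hnb hi).2
  exact ⟨localRelStar_trans (localRelStar_symm h) h, by rwa [psp_edgeSet], by rwa [psp_edgeSet]⟩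

end Own

end Graph

/-! ## The adjacency matrix and the test for `δ` -/

section Static

variable {V : Type*} {n : ℕ}

@[simp] theorem code_inj (num : V ≃ Fin n) {u v : V} : code num u = code num v ↔ u = v := by
  simp [code, Fin.ext_iff.symm]

theorem code_lt (num : V ≃ Fin n) (v : V) : code num v < n := (num v).2

theorem exists_code (num : V ≃ Fin n) {i : ℕ} (hi : i < n) : ∃ v, code num v = i :=
  ⟨num.symm ⟨i, hi⟩, by simp [code]⟩

/-- The memory holds the adjacency lists of `G` (where `nb v k` is the `k`-th neighbour of `v`)
and the adjacency matrix, and the degrees are at most `D`. -/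
structure Static [Fintype V] (G : SimpleGraph V) [DecidableRel G.Adj] (num : V ≃ Fin n)
    (nb : V → ℕ → V) (D : ℕ) (M : Mem) : Prop where
  pos : 1 ≤ D
  bij : ∀ v, Set.BijOn (nb v) (Set.Iio (G.degree v)) (G.neighborSet v)
  deg_le : ∀ v, G.degree v ≤ D
  deg : ∀ v, M .deg (code num v) 0 = G.degree v
  nbr : ∀ v k, k < G.degree v → M .nbr (code num v) k = code num (nb v k)
  adj : ∀ u v, M .adj (code num u) (code num v) = 1 ↔ G.Adj u v

variable [Fintype V] {G : SimpleGraph V} [DecidableRel G.Adj] {num : V ≃ Fin n}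
  {nb : V → ℕ → V} {D : ℕ} {M M' : Mem}

theorem Static.frame {S : List Arr} (h : Static G num nb D M) (hF : Frame S M M')
    (h1 : Arr.deg ∉ S := by decide) (h2 : Arr.nbr ∉ S := by decide)
    (h3 : Arr.adj ∉ S := by decide) : Static G num nb D M' where
  pos := h.pos
  bij := h.bij
  deg_le := h.deg_le
  deg v := by rw [hF _ h1, h.deg]
  nbr v k hk := by rw [hF _ h2, h.nbr v k hk]
  adj u v := by rw [hF _ h3, h.adj]

theorem Static.adj_nb (h : Static G num nb D M) {v : V} {k : ℕ} (hk : k < G.degree v) :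
    G.Adj v (nb v k) := (h.bij v).mapsTo hk

theorem Static.exists_nb (h : Static G num nb D M) {u v : V} (huv : G.Adj v u) :
    ∃ k < G.degree v, nb v k = u := exists_pos (h.bij v) huv

/-- Bookkeeping for nested loops: each level raises the exponent of D by one and the constant by
two. The overheads are absorbed because D ≥ 1. -/
theorem loop_le {d t c j : ℕ} (hD : 1 ≤ D) (hd : d ≤ D) (ht : t ≤ c * D ^ j) :
    d * (t + 1) + 1 ≤ (c + 2) * D ^ (j + 1) := by
  have h1 : 1 ≤ D ^ j := Nat.one_le_pow _ _ hD
  have h2 : d * (t + 1) ≤ D * ((c + 1) * D ^ j) := by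
    apply Nat.mul_le_mul hd
    rw [Nat.succ_mul]
    omega
  have h3 : 1 ≤ D ^ (j + 1) := Nat.one_le_pow _ _ hD
  calc d * (t + 1) + 1 ≤ D * ((c + 1) * D ^ j) + D ^ (j + 1) := by omega
    _ = (c + 2) * D ^ (j + 1) := by ring

theorem pow_le_pow_succ' (hD : 1 ≤ D) (j : ℕ) : D ^ j ≤ D ^ (j + 1) :=
  Nat.pow_le_pow_right hD (Nat.le_succ j)

/-- Only the entries of actual adjacencies are written. The others are right because memory starts
at 0, so the cost is n · D rather than n². -/
theorem buildAdj_spec (hbij : ∀ v, Set.BijOn (nb v) (Set.Iio (G.degree v)) (G.neighborSet v))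
    (hD : 1 ≤ D) (hle : ∀ v, G.degree v ≤ D) (hn : M .size 0 0 = n)
    (hdeg : ∀ v, M .deg (code num v) 0 = G.degree v)
    (hnbr : ∀ v k, k < G.degree v → M .nbr (code num v) k = code num (nb v k))
    (hadj : ∀ i j, M .adj i j = 0) :
    Spec buildAdj M (n * (12 * D) + 3)
      fun _ M' => Static G num nb D M' ∧ Frame [.adj] M M' := by
  classical
  simp only [buildAdj, Spec, wp_bind, wp_get, hn]
  refine wp_forLoop (fun i M' => Frame [.adj] M M' ∧ ∀ u v, M' .adj (code num u) (code num v) = 1 ↔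
    G.Adj u v ∧ code num u < i) (10 * D) ?_ ?_ ?_
  · exact ⟨.refl _ _, fun u v => by simp [hadj]⟩
  · rintro i hi M₁ ⟨hF, h1⟩
    obtain ⟨v, rfl⟩ := exists_code num hi
    simp only [Spec, wp_getAt, wp_bind]
    rw [hF .deg (by decide), hdeg]
    refine wp_forLoop (fun k M' => Frame [.adj] M M' ∧ ∀ a b,
      M' .adj (code num a) (code num b) = 1 ↔ (G.Adj a b ∧ code num a < code num v) ∨
        (a = v ∧ ∃ j < k, nb v j = b)) 4 ⟨hF, fun a b => by simp [h1]⟩ ?_ ?_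
    · rintro k hk M₂ ⟨hF₂, h2⟩
      simp only [Spec, wp_load, wp_bind, wp_setFlag]
      rw [hF₂ .nbr (by decide), hnbr v k hk]
      refine ⟨⟨hF₂.set (by decide) _ _ _, fun a b => ?_⟩, by omega⟩
      rw [Mem.set_self]
      simp only [code_inj]
      split
      · rename_i h
        simp only [h, true_iff]
        exact .inr ⟨trivial, k, by omega, rfl⟩
      · rename_i h
        rw [h2]
        simp only [Nat.lt_succ_iff_lt_or_eq]
        grind
    · rintro M₂ s' ⟨hF₂, h2⟩ hs
      refine ⟨⟨hF₂, fun a b => ?_⟩, ?_⟩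
      · rw [h2, Nat.lt_succ_iff_lt_or_eq, code_inj]
        constructor
        · rintro (h | ⟨rfl, j, hj, rfl⟩)
          · tauto
          · exact ⟨(hbij a).mapsTo hj, .inr rfl⟩
        · rintro ⟨h, h' | rfl⟩
          · exact .inl ⟨h, h'⟩
          · exact .inr ⟨rfl, exists_pos (hbij a) h⟩
      · have := hle v
        omega
  · rintro M₁ s ⟨hF, h1⟩ hs
    refine ⟨⟨⟨hD, hbij, hle, fun v => by rw [hF .deg (by decide), hdeg],
      fun v k hk => by rw [hF .nbr (by decide), hnbr v k hk], fun u v => ?_⟩, hF⟩, ?_⟩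
    · rw [h1]
      exact ⟨fun h => h.1, fun h => ⟨h, code_lt _ _⟩⟩
    · have : n * (10 * D + 1) ≤ n * (12 * D) := Nat.mul_le_mul le_rfl (by omega)
      omega

/-- Squares spanned by cp and cq correspond to their fourth vertices, which are found in the list of
p. The chord pq is settled in advance and the chord from c to the fourth vertex by the flag; the
edges are unrelated exactly when the count is 1 and the flag is unset. -/
theorem adjacentRelated_spec (hM : Static G num nb D M) {c p q : V} (hp : G.Adj c p)
    (hq : G.Adj c q) (hpq : p ≠ q) :
    Spec (adjacentRelated (code num c) (code num p) (code num q)) M (50 * D) fun b M' =>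
      (b = true ↔ delta G s(c, p) s(c, q)) ∧ Frame [.count, .chord] M M' := by
  classical
  have hD := hM.pos
  rw [delta_adjacent_iff hp hq hpq]
  simp only [adjacentRelated, Spec, wp_bind, wp_flagged, wp_zero, wp_ite, wp_pure, wp_put,
    wp_getAt, hM.adj, decide_eq_true_eq]
  split
  · rename_i h
    refine ⟨⟨?_, .refl _ _⟩, by omega⟩
    simp only [true_iff]
    rintro ⟨x, hx, -⟩
    exact hx.2.2 h
  · rename_i hnpq
    set M₁ := (M.set .count 0 0 0).set .chord 0 0 0 with hM₁
    have hF₁ : Frame [.count, .chord] M M₁ :=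
      ((Frame.refl _ _).set (by decide) _ _ _).set (by decide) _ _ _
    have hS₁ := hM.frame hF₁
    rw [hS₁.deg]
    -- The positions of the fourth vertices of squares spanned by cp and cq.
    let P : ℕ → Prop := fun k => nb p k ≠ c ∧ G.Adj (nb p k) q
    refine wp_forLoop (fun i M' => Frame [.count, .chord] M M' ∧
      M' .count 0 0 = ((Finset.range i).filter P).card ∧
      (M' .chord 0 0 = 1 ↔ ∃ k < i, P k ∧ G.Adj (nb p k) c)) 18 ?_ ?_ ?_
    · refine ⟨hF₁, ?_, ?_⟩ <;> simp [hM₁, Mem.set]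
    · rintro k hk M₂ ⟨hF, h1, h2⟩
      have hS := hM.frame hF
      simp only [Spec, wp_load, wp_bind, wp_eq, wp_flagged, wp_ite, wp_increment, wp_setFlag,
        wp_pure, hS.nbr p k hk, hS.adj, code_inj]
      have hcard : ((Finset.range (k + 1)).filter P).card =
          ((Finset.range k).filter P).card + if P k then 1 else 0 := by
        rw [Finset.range_add_one, Finset.filter_insert]
        split <;> simp
      have hex : (∃ j < k + 1, P j ∧ G.Adj (nb p j) c) ↔
          (∃ j < k, P j ∧ G.Adj (nb p j) c) ∨ (P k ∧ G.Adj (nb p k) c) := by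
        simp only [Nat.lt_succ_iff_lt_or_eq]
        grind
      rw [hcard, hex]
      by_cases hP : P k
      · have hP' : (decide (G.Adj (nb p k) q) && !decide (nb p k = c)) = true := by
          simp [hP.1, hP.2]
        rw [if_pos hP']
        have hF₃ : Frame [.count, .chord] M (M₂.set .count 0 0 (M₂ .count 0 0 + 1)) :=
          hF.set (by decide) _ _ _
        simp only [(hM.frame hF₃).adj, decide_eq_true_eq]
        split
        · rename_i hadj
          refine ⟨⟨hF₃.set (by decide) _ _ _, ?_, ?_⟩, by omega⟩ <;> simp [Mem.set, h1, hP, hadj]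
        · rename_i hadj
          refine ⟨⟨hF₃, ?_, ?_⟩, by omega⟩ <;> simp [Mem.set, h1, h2, hadj, hP]
      · have hP' : ¬ (decide (G.Adj (nb p k) q) && !decide (nb p k = c)) = true := by
          simpa [P, and_comm] using hP
        rw [if_neg hP']
        exact ⟨⟨hF, by simp [h1, hP], by simp [h2, hP]⟩, by omega⟩
    · rintro M₂ s ⟨hF, h1, h2⟩ hs
      simp only [wp_get, wp_one, wp_eq]
      refine ⟨⟨?_, hF⟩, ?_⟩
      · simp only [Bool.not_eq_true', Bool.and_eq_false_iff, decide_eq_false_iff_not,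
          Bool.not_eq_false', decide_eq_true_eq, h1, h2]
        rw [← not_iff_not]
        push Not
        constructor
        · rintro ⟨h3, h4⟩
          obtain ⟨k, hk⟩ := Finset.card_eq_one.1 h3
          have hmem : ∀ j, (j < G.degree p ∧ P j) ↔ j = k := fun j => by
            have := Finset.ext_iff.1 hk j
            simpa using this
          obtain ⟨hkd, hP⟩ := (hmem k).2 rfl
          refine ⟨nb p k, ⟨⟨hp, hM.adj_nb hkd, hP.2, hq.symm, hP.1.symm, hpq⟩,
            fun h => h4 k hkd hP h.symm, hnpq⟩, fun y hy => ?_⟩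
          obtain ⟨j, hj, rfl⟩ := hM.exists_nb hy.2.1
          rw [(hmem j).1 ⟨hj, hy.2.2.2.2.1.symm, hy.2.2.1⟩]
        · rintro ⟨x, hx, hu⟩
          obtain ⟨k, hk, rfl⟩ := hM.exists_nb hx.1.2.1
          have huniq : ∀ j < G.degree p, P j → j = k := fun j hj hP =>
            (hM.bij p).injOn hj hk
              (hu _ ⟨hp, hM.adj_nb hj, hP.2, hq.symm, hP.1.symm, hpq⟩)
          have hPk : P k := ⟨hx.1.2.2.2.2.1.symm, hx.1.2.2.1⟩
          refine ⟨Finset.card_eq_one.2 ⟨k, ?_⟩, fun j hj hP h => ?_⟩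
          · ext j
            simp only [Finset.mem_filter, Finset.mem_range, Finset.mem_singleton]
            exact ⟨fun h => huniq j h.1 h.2, fun h => h ▸ ⟨hk, hPk⟩⟩
          · rw [huniq j hj hP] at h
            exact hx.2.1 h.symm
      · have := hM.deg_le p
        omega

theorem deltaTest_spec (hM : Static G num nb D M) {p q a b : V} (hpq : G.Adj p q)
    (hab : G.Adj a b) :
    Spec (deltaTest (code num p) (code num q) (code num a) (code num b)) M (60 * D) fun r M' =>
      (r = true ↔ delta G s(p, q) s(a, b)) ∧ Frame [.count, .chord] M M' := by
  have hD := hM.pos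
  classical
  simp only [deltaTest, Spec, wp_bind, wp_eq, wp_ite, wp_pure, code_inj, decide_eq_true_eq]
  split
  · rename_i hpa
    subst hpa
    split
    · rename_i hqb
      subst hqb
      exact ⟨⟨by simp [delta_refl (show s(p, q) ∈ G.edgeSet from hpq)], .refl _ _⟩, by omega⟩
    · rename_i hqb
      exact (adjacentRelated_spec hM hpq hab hqb).wp fun r M' s h hs => ⟨h, by omega⟩
  · rename_i hpa
    split
    · rename_i hpb
      subst hpb
      rw [Sym2.eq_swap (a := a)]
      split
      · rename_i hqa
        subst hqa
        exact ⟨⟨by simp [delta_refl (show s(p, q) ∈ G.edgeSet from hpq)], .refl _ _⟩, by omega⟩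
      · rename_i hqa
        exact (adjacentRelated_spec hM hpq hab.symm hqa).wp fun r M' s h hs => ⟨h, by omega⟩
    · rename_i hpb
      split
      · rename_i hqa
        subst hqa
        rw [Sym2.eq_swap (a := p)]
        exact (adjacentRelated_spec hM hpq.symm hab hpb).wp fun r M' s h hs => ⟨h, by omega⟩
      · rename_i hqa
        split
        · rename_i hqb
          subst hqb
          rw [Sym2.eq_swap (a := p), Sym2.eq_swap (a := a)]
          exact (adjacentRelated_spec hM hpq.symm hab.symm hpa).wp
            fun r M' s h hs => ⟨h, by omega⟩
        · rename_i hqb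
          rw [delta_disjoint_iff hpq hab hpa hpb hqa hqb]
          simp only [oppositeRelated, wp_bind, wp_flagged, wp_pure, hM.adj]
          refine ⟨⟨?_, .refl _ _⟩, by omega⟩
          simp [and_assoc]

end Static

/-! ## The local classes -/

section Local

/-- The table still holds the values of the vertex scanned before; only the d × d corner in use has
to be reset. -/
theorem clearLoc_spec {M : Mem} (d : ℕ) :
    Spec (.forLoop d fun i => .forLoop d fun k => .store .loc i k 0) M
      (d * (d * 2 + 1 + 1) + 1) fun _ M' =>
        Frame [.loc] M M' ∧ ∀ i < d, ∀ k < d, M' .loc i k = 0 := by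
  refine wp_forLoop (fun i M' => Frame [.loc] M M' ∧ ∀ a < i, ∀ k < d, M' .loc a k = 0)
    (d * 2 + 1) ⟨.refl _ _, by simp⟩ ?_ fun M' s h hs => ⟨h, by omega⟩
  rintro i hi M₁ ⟨hF, h1⟩
  refine wp_forLoop (fun j M' => Frame [.loc] M M' ∧ (∀ a < i, ∀ k < d, M' .loc a k = 0) ∧
    ∀ k < j, M' .loc i k = 0) 1 ⟨hF, h1, by simp⟩ ?_ ?_
  · rintro k hk M₂ ⟨hF₂, h2, h3⟩
    simp only [Spec, wp_store]
    refine ⟨⟨hF₂.set (by decide) _ _ _, fun a ha b hb => ?_, fun b hb => ?_⟩, by omega⟩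
    · rw [Mem.set_self]
      split <;> simp_all
    · rw [Mem.set_self]
      split
      · rfl
      · exact h3 b (by omega)
  · rintro M₂ s ⟨hF₂, h2, h3⟩ hs
    refine ⟨⟨hF₂, fun a ha k hk => ?_⟩, by omega⟩
    rcases Nat.lt_succ_iff_lt_or_eq.1 ha with ha | rfl
    exacts [h2 a ha k hk, h3 k hk]

theorem markHits_spec {M : Mem} (d : ℕ) :
    Spec (.forLoop d fun i => do
        let hi ← flagged .hit i 0
        if hi then
          Prog.forLoop d fun k => do
            let hk ← flagged .hit k 0
            if hk then setFlag .loc i k) M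
      (d * (d * 8 + 5 + 1) + 1) fun _ M' =>
        Frame [.loc] M M' ∧ ∀ i < d, ∀ k < d,
          M' .loc i k = 1 ↔ M .loc i k = 1 ∨ M .hit i 0 = 1 ∧ M .hit k 0 = 1 := by
  refine wp_forLoop (fun i M' => Frame [.loc] M M' ∧ ∀ a < d, ∀ b < d,
    M' .loc a b = 1 ↔ M .loc a b = 1 ∨ a < i ∧ M .hit a 0 = 1 ∧ M .hit b 0 = 1)
    (d * 8 + 5) ⟨.refl _ _, by simp⟩ ?_ ?_
  · rintro i hi M₁ ⟨hF, h1⟩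
    simp only [Spec, wp_bind, wp_flagged, wp_ite, wp_pure, decide_eq_true_eq]
    rw [hF .hit (by decide)]
    split
    · rename_i hhi
      refine wp_forLoop (fun k M' => Frame [.loc] M M' ∧ ∀ a < d, ∀ b < d,
        M' .loc a b = 1 ↔ M .loc a b = 1 ∨ a < i ∧ M .hit a 0 = 1 ∧ M .hit b 0 = 1 ∨
          a = i ∧ b < k ∧ M .hit b 0 = 1) 7 ⟨hF, fun a ha b hb => by simp [h1 a ha b hb]⟩ ?_ ?_
      · rintro k hk M₂ ⟨hF₂, h2⟩
        simp only [Spec, wp_bind, wp_flagged, wp_ite, wp_pure, decide_eq_true_eq, wp_setFlag]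
        rw [hF₂ .hit (by decide)]
        split
        · rename_i hhk
          refine ⟨⟨hF₂.set (by decide) _ _ _, fun a ha b hb => ?_⟩, by omega⟩
          rw [Mem.set_self]
          split
          · rename_i h
            simp [h, hhk]
          · rename_i h
            rw [h2 a ha b hb, Nat.lt_succ_iff_lt_or_eq]
            tauto
        · rename_i hhk
          refine ⟨⟨hF₂, fun a ha b hb => ?_⟩, by omega⟩
          rw [h2 a ha b hb, Nat.lt_succ_iff_lt_or_eq]
          grind
      · rintro M₂ s ⟨hF₂, h2⟩ hs
        refine ⟨⟨hF₂, fun a ha b hb => ?_⟩, by omega⟩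
        rw [h2 a ha b hb, Nat.lt_succ_iff_lt_or_eq]
        grind
    · rename_i hhi
      refine ⟨⟨hF, fun a ha b hb => ?_⟩, by omega⟩
      rw [h1 a ha b hb, Nat.lt_succ_iff_lt_or_eq]
      grind
  · rintro M₁ s ⟨hF, h1⟩ hs
    refine ⟨⟨hF, fun i hi k hk => ?_⟩, by omega⟩
    rw [h1 i hi k hk]
    tauto

variable {V : Type*} {n : ℕ} [Fintype V] {G : SimpleGraph V} [DecidableRel G.Adj] {num : V ≃ Fin n}
  {nb : V → ℕ → V} {D : ℕ} {M M' : Mem}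

theorem testHits_spec (hM : Static G num nb D M) {v a b : V} (hab : G.Adj a b) :
    Spec (.forLoop (G.degree v) fun i => do
        let u ← Prog.load .nbr (code num v) i
        let r ← deltaTest (code num v) u (code num a) (code num b)
        if r then setFlag .hit i 0 else putAt .hit i 0) M
      (G.degree v * (64 * D + 1) + 1) fun _ M' => Frame [.count, .chord, .hit] M M' ∧
        ∀ i < G.degree v, M' .hit i 0 = 1 ↔ delta G s(v, nb v i) s(a, b) := by
  refine wp_forLoop (fun j M' => Frame [.count, .chord, .hit] M M' ∧
    ∀ i < j, M' .hit i 0 = 1 ↔ delta G s(v, nb v i) s(a, b))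
    (64 * D) ⟨.refl _ _, by simp⟩ ?_ fun M' s h hs => ⟨h, by omega⟩
  rintro i hi M₁ ⟨hF, h1⟩
  have hD := hM.pos
  have hS := hM.frame hF
  simp only [Spec, wp_bind, wp_load, wp_ite]
  rw [hS.nbr v i hi]
  refine (deltaTest_spec hS (hM.adj_nb hi) hab).wp ?_
  rintro r M₂ s ⟨hr, hF₂⟩ hs
  have hF₂' : Frame [.count, .chord, .hit] M M₂ := hF.trans (hF₂.mono (by decide))
  simp only [wp_setFlag, wp_putAt]
  split
  · rename_i hrt
    refine ⟨⟨hF₂'.set (by decide) _ _ _, fun k hk => ?_⟩, by omega⟩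
    rw [Mem.set_self]
    split
    · rename_i h
      simp [h.1, hr.1 hrt]
    · rename_i h
      rw [hF₂ .hit (by decide), h1 k (by omega)]
  · rename_i hrt
    refine ⟨⟨hF₂'.set (by decide) _ _ _, fun k hk => ?_⟩, by omega⟩
    rw [Mem.set_self]
    split
    · rename_i h
      simp [h.1, ← hr, hrt]
    · rename_i h
      rw [hF₂ .hit (by decide), h1 k (by omega)]

/-- The dominant part of the algorithm: at most D² candidates ab, each with D tests of cost O(D) and
D² updates of the table. The table accumulates, over all candidates, the pairs of positions that are
both related to the candidate. -/
theorem computeLoc_spec (hM : Static G num nb D M) (v : V) :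
    Spec (computeLoc (code num v)) M (110 * D ^ 4) fun _ M' =>
      Frame [.count, .chord, .hit, .loc] M M' ∧ ∀ i < G.degree v, ∀ k < G.degree v,
        M' .loc i k = 1 ↔ CommonDelta G v s(v, nb v i) s(v, nb v k) := by
  have hD := hM.pos
  have hdv := hM.deg_le v
  set d := G.degree v with hd
  have hD1 := pow_le_pow_succ' hD 1
  have hD2 := pow_le_pow_succ' hD 2
  have hD3 := pow_le_pow_succ' hD 3
  norm_num at hD1 hD2 hD3
  simp only [computeLoc, Spec, wp_bind, wp_getAt, wp_zero]
  rw [hM.deg, ← hd]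
  refine (clearLoc_spec d).wp ?_
  rintro - M₁ s₁ ⟨hF₁, h1⟩ hs₁
  have hF₁' : Frame [.count, .chord, .hit, .loc] M M₁ := hF₁.mono (by decide)
  let R : V → V → ℕ → ℕ → Prop := fun a b i k =>
    delta G s(v, nb v i) s(a, b) ∧ delta G s(v, nb v k) s(a, b)
  refine wp_forLoop (fun j M' => Frame [.count, .chord, .hit, .loc] M M' ∧
    ∀ i < d, ∀ k < d, M' .loc i k = 1 ↔
      ∃ j' < j, ∃ l < G.degree (nb v j'), R (nb v j') (nb (nb v j') l) i k)
    (92 * D ^ 3) ⟨hF₁', fun i hi k hk => by simp [h1 i hi k hk]⟩ ?_ ?_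
  · rintro j hj M₂ ⟨hF₂, h2⟩
    have hS₂ := hM.frame hF₂
    simp only [Spec, wp_load, wp_getAt, wp_bind]
    rw [hS₂.nbr v j hj, hS₂.deg]
    set a := nb v j with ha
    refine wp_forLoop (fun l M' => Frame [.count, .chord, .hit, .loc] M M' ∧
      ∀ i < d, ∀ k < d, M' .loc i k = 1 ↔
        (∃ j' < j, ∃ l < G.degree (nb v j'), R (nb v j') (nb (nb v j') l) i k) ∨
          ∃ l' < l, R a (nb a l') i k)
      (84 * D ^ 2) ⟨hF₂, fun i hi k hk => by simp [h2 i hi k hk]⟩ ?_ ?_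
    · rintro l hl M₃ ⟨hF₃, h3⟩
      have hS₃ := hM.frame hF₃
      simp only [Spec, wp_load, wp_bind]
      rw [hS₃.nbr a l hl]
      refine (testHits_spec hS₃ (hM.adj_nb hl)).wp ?_
      rintro - M₄ s₄ ⟨hF₄, h4⟩ hs₄
      refine (markHits_spec d).wp ?_
      rintro - M₅ s₅ ⟨hF₅, h5⟩ hs₅
      refine ⟨⟨hF₃.trans ((hF₄.mono (by decide)).trans (hF₅.mono (by decide))),
        fun i hi k hk => ?_⟩, ?_⟩
      · rw [h5 i hi k hk, h4 i hi, h4 k hk, hF₄ .loc (by decide), h3 i hi k hk,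
          Nat.exists_lt_succ_right, or_assoc]
      -- One candidate costs at most 66D² for the tests and 15D² for the updates, within the 84D²
      -- allowed.
      · have e1 := loop_le (c := 64) (j := 1) (t := 64 * D) hD hdv (by rw [pow_one])
        have e2 := loop_le (c := 13) (j := 1) (t := d * 8 + 5) hD hdv (by rw [pow_one]; omega)
        have := Nat.one_le_pow 2 D hD
        norm_num at e1 e2
        rw [← hd] at hs₄
        omega
    · rintro M₃ s₃ ⟨hF₃, h3⟩ hs₃
      refine ⟨⟨hF₃, fun i hi k hk => ?_⟩, ?_⟩
      · rw [h3 i hi k hk, Nat.exists_lt_succ_right]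
      · have e := loop_le (c := 84) (j := 2) hD (hM.deg_le a)
          le_rfl
        norm_num at e hs₃
        have : 1 ≤ D ^ 3 := Nat.one_le_pow _ _ hD
        omega
  · rintro M₂ s₂ ⟨hF₂, h2⟩ hs₂
    refine ⟨⟨hF₂, fun i hi k hk => ?_⟩, ?_⟩
    · rw [h2 i hi k hk]
      constructor
      · rintro ⟨j, hj, l, hl, h⟩
        exact ⟨_, _, hM.adj_nb hj, hM.adj_nb hl, h⟩
      · rintro ⟨a, b, ha, hb, h⟩
        obtain ⟨j, hj, rfl⟩ := hM.exists_nb ha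
        obtain ⟨l, hl, rfl⟩ := hM.exists_nb hb
        exact ⟨j, hj, l, hl, h⟩
    · have e1 := loop_le (c := 92) (j := 3) hD hdv le_rfl
      have e2 : d * (d * 2 + 1 + 1) + 1 ≤ _ :=
        loop_le (c := 3) (j := 1) hD hdv (by rw [pow_one]; omega)
      norm_num at e1 e2
      omega

theorem closeRound_spec {k d : ℕ} (hk : k < d) :
    Spec (.forLoop d fun i => do
      let ik ← flagged .loc i k
      if ik then
        Prog.forLoop d fun j => do
          let kj ← flagged .loc k j
          if kj then setFlag .loc i j) M (d * (d * 8 + 5 + 1) + 1) fun _ M' =>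
      Frame [.loc] M M' ∧ ∀ i < d, ∀ j < d,
        M' .loc i j = 1 ↔ M .loc i j = 1 ∨ M .loc i k = 1 ∧ M .loc k j = 1 := by
  refine wp_forLoop (fun i M' => Frame [.loc] M M' ∧ ∀ a < d, ∀ b < d,
    M' .loc a b = 1 ↔ M .loc a b = 1 ∨ a < i ∧ M .loc a k = 1 ∧ M .loc k b = 1)
    (d * 8 + 5) ⟨.refl _ _, by simp⟩ ?_ ?_
  · rintro i hi M₁ ⟨hF, h1⟩
    classical
    simp only [Spec, wp_bind, wp_flagged, wp_ite, wp_pure, decide_eq_true_eq]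
    -- Round k may be done in place: column k is unchanged by it, since the entry (i, k) could only
    -- be set if it already was. The same holds for row k below.
    have e : M₁ .loc i k = 1 ↔ M .loc i k = 1 := by
      rw [h1 i hi k hk]
      tauto
    simp only [e]
    split
    · rename_i hik
      refine wp_forLoop (fun j M' => Frame [.loc] M M' ∧ ∀ a < d, ∀ b < d,
        M' .loc a b = 1 ↔ M .loc a b = 1 ∨ a < i ∧ M .loc a k = 1 ∧ M .loc k b = 1 ∨
          a = i ∧ b < j ∧ M .loc k b = 1) 7 ⟨hF, fun a ha b hb => by simp [h1 a ha b hb]⟩ ?_ ?_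
      · rintro j hj M₂ ⟨hF₂, h2⟩
        simp only [Spec, wp_bind, wp_flagged, wp_ite, wp_pure, decide_eq_true_eq, wp_setFlag]
        have e : M₂ .loc k j = 1 ↔ M .loc k j = 1 := by
          rw [h2 k hk j hj]
          tauto
        simp only [e]
        split
        · rename_i hkj
          refine ⟨⟨hF₂.set (by decide) _ _ _, fun a ha b hb => ?_⟩, by omega⟩
          rw [Mem.set_self]
          split
          · rename_i h
            simp [h, hkj]
          · rename_i h
            rw [h2 a ha b hb, Nat.lt_succ_iff_lt_or_eq]
            tauto
        · rename_i hkj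
          refine ⟨⟨hF₂, fun a ha b hb => ?_⟩, by omega⟩
          rw [h2 a ha b hb, Nat.lt_succ_iff_lt_or_eq]
          grind
      · rintro M₂ s ⟨hF₂, h2⟩ hs
        refine ⟨⟨hF₂, fun a ha b hb => ?_⟩, by omega⟩
        rw [h2 a ha b hb, Nat.lt_succ_iff_lt_or_eq]
        grind
    · rename_i hik
      refine ⟨⟨hF, fun a ha b hb => ?_⟩, by omega⟩
      rw [h1 a ha b hb, Nat.lt_succ_iff_lt_or_eq]
      grind
  · rintro M₁ s ⟨hF, h1⟩ hs
    refine ⟨⟨hF, fun i hi j hj => ?_⟩, by omega⟩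
    rw [h1 i hi j hj]
    tauto

/-- Warshall's algorithm. The table always lies between R and its transitive closure, and after
round k it is closed under composition through every position up to k; in the end it is transitive,
hence equal to the closure. -/
theorem closeLoc_spec (hM : Static G num nb D M) (v : V) {R : ℕ → ℕ → Prop}
    (hR : ∀ i k, R i k → i < G.degree v ∧ k < G.degree v)
    (hloc : ∀ i < G.degree v, ∀ k < G.degree v, M .loc i k = 1 ↔ R i k) :
    Spec (closeLoc (code num v)) M (20 * D ^ 3) fun _ M' =>
      Frame [.loc] M M' ∧ ∀ i < G.degree v, ∀ k < G.degree v,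
        M' .loc i k = 1 ↔ Relation.TransGen R i k := by
  have hD := hM.pos
  have hdv := hM.deg_le v
  simp only [closeLoc, Spec, wp_bind, wp_getAt]
  rw [hM.deg]
  set d := G.degree v with hd
  refine wp_forLoop (fun k M' => Frame [.loc] M M' ∧
    (∀ i j, R i j → M' .loc i j = 1) ∧
    (∀ i < d, ∀ j < d, M' .loc i j = 1 → Relation.TransGen R i j) ∧
    ∀ l < k, ∀ i < d, ∀ j < d, M' .loc i l = 1 → M' .loc l j = 1 → M' .loc i j = 1)
    (d * (d * 8 + 5 + 1) + 1) ?_ ?_ ?_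
  · exact ⟨.refl _ _, fun i j h => (hloc i (hR i j h).1 j (hR i j h).2).2 h,
      fun i hi j hj h => .single ((hloc i hi j hj).1 h), by simp⟩
  · rintro k hk M₁ ⟨hF, h1, h2, h3⟩
    refine (closeRound_spec hk).wp ?_
    rintro - M₂ s ⟨hF₂, h4⟩ hs
    refine ⟨⟨hF.trans hF₂, fun i j h => ?_, fun i hi j hj h => ?_, ?_⟩, by omega⟩
    · exact (h4 i (hR i j h).1 j (hR i j h).2).2 (.inl (h1 i j h))
    · rcases (h4 i hi j hj).1 h with h | ⟨h, h'⟩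
      · exact h2 i hi j hj h
      · exact (h2 i hi k hk h).trans (h2 k hk j hj h')
    · intro l hl i hi j hj hil hlj
      have hld : l < d := by omega
      rw [h4 i hi l hld] at hil
      rw [h4 l hld j hj] at hlj
      rw [h4 i hi j hj]
      rcases Nat.lt_succ_iff_lt_or_eq.1 hl with hl | rfl
      · have := h3 l hl
        grind
      · tauto
  · rintro M₁ s ⟨hF, h1, h2, h3⟩ hs
    refine ⟨⟨hF, fun i hi k hk => ⟨h2 i hi k hk, fun h => ?_⟩⟩, ?_⟩
    · induction h with
      | single h => exact h1 _ _ h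
      | tail _ h ih =>
        have := hR _ _ h
        exact h3 _ this.1 _ hi _ this.2 (ih this.1) (h1 _ _ h)
    · have e1 := loop_le (c := 13) (j := 1) (t := d * 8 + 5) hD hdv (by rw [pow_one]; omega)
      have e2 := loop_le (c := 15) (j := 2) hD hdv e1
      have := Nat.one_le_pow 3 D hD
      norm_num at e2
      omega

/-- The new colours fill an interval directly above those in use before. Hence they are distinct
from all earlier colours and none is left without an edge, which the global argument needs. -/
theorem assignColours_spec (hM : Static G num nb D M) (v : V) {E : ℕ → ℕ → Prop}
    (hrefl : ∀ i < G.degree v, E i i) (hsymm : ∀ i k, E i k → E k i)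
    (htrans : ∀ i j k, E i j → E j k → E i k)
    (hloc : ∀ i < G.degree v, ∀ k < G.degree v, M .loc i k = 1 ↔ E i k) :
    Spec (assignColours (code num v)) M (50 * D ^ 2) fun _ M' =>
      Frame [.old, .locCol, .numCol] M M' ∧ M .numCol 0 0 ≤ M' .numCol 0 0 ∧
      M' .numCol 0 0 ≤ M .numCol 0 0 + D ∧
      (∀ i < G.degree v, ∀ k < G.degree v, M' .locCol i 0 = M' .locCol k 0 ↔ E i k) ∧
      (∀ c, (∃ i < G.degree v, c = M' .locCol i 0) ↔ M .numCol 0 0 < c ∧ c ≤ M' .numCol 0 0) := by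
  have hD := hM.pos
  have hdv := hM.deg_le v
  classical
  simp only [assignColours, Spec, wp_bind, wp_getAt, wp_zero]
  rw [hM.deg]
  set d := G.degree v with hd
  set N := M .numCol 0 0 with hN
  refine wp_forLoop (fun i M' => Frame [.old, .locCol, .numCol] M M' ∧ N ≤ M' .numCol 0 0 ∧
    M' .numCol 0 0 ≤ N + i ∧
    (∀ a < i, ∀ b < i, M' .locCol a 0 = M' .locCol b 0 ↔ E a b) ∧
    (∀ c, (∃ a < i, c = M' .locCol a 0) ↔ N < c ∧ c ≤ M' .numCol 0 0)) (37 * D)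
    ⟨.refl _ _, le_rfl, le_rfl, by simp, by intro c; simp; omega⟩ ?_ ?_
  · rintro i hi M₁ ⟨hF, h1, h2, h3, h4⟩
    simp only [Spec, wp_bind, wp_put]
    refine wp_forLoop (fun k M' => Frame [.old, .locCol, .numCol] M M' ∧
      M' .numCol 0 0 = M₁ .numCol 0 0 ∧ (∀ a < i, M' .locCol a 0 = M₁ .locCol a 0) ∧
      (M' .old 0 0 = 1 ↔ ∃ b < k, E i b) ∧ ∀ b < k, E i b → M' .locCol i 0 = M₁ .locCol b 0) 11
      ⟨hF.set (by decide) _ _ _, by simp [Mem.set], by simp [Mem.set], by simp [Mem.set],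
        by simp⟩ ?_ ?_
    · rintro k hk M₂ ⟨hF₂, h5, h6, h7, h8⟩
      have hik : M₂ .loc i k = 1 ↔ E i k := by
        rw [hF₂ .loc (by decide), hloc i hi k (hk.trans hi)]
      simp only [Spec, wp_bind, wp_flagged, wp_ite, wp_pure, decide_eq_true_eq, hik, wp_getAt,
        wp_putAt, wp_setFlag]
      split
      · rename_i hE
        refine ⟨⟨(hF₂.set (by decide) _ _ _).set (by decide) _ _ _, by simp [Mem.set, h5],
          fun a ha => ?_, ?_, fun b hb hEb => ?_⟩, by omega⟩
        · simp [Mem.set, h6 a ha, ha.ne]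
        · simp only [Mem.set_self, and_self, if_true, true_iff]
          exact ⟨k, by omega, hE⟩
        -- The colour of position i may be overwritten several times, but all earlier members of its
        -- class carry the same colour.
        · simp only [Mem.set, reduceCtorEq, false_and, if_false, and_self, if_true, h6 k hk]
          exact (h3 k hk b (by omega)).2 (htrans _ _ _ (hsymm _ _ hE) hEb)
      · rename_i hE
        refine ⟨⟨hF₂, h5, h6, ?_, fun b hb hEb => ?_⟩, by omega⟩
        · rw [h7]
          simp only [Nat.lt_succ_iff_lt_or_eq]
          grind
        · rcases Nat.lt_succ_iff_lt_or_eq.1 hb with hb | rfl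
          exacts [h8 b hb hEb, absurd hEb hE]
    · rintro M₂ s ⟨hF₂, h5, h6, h7, h8⟩ hs
      have hii := hrefl i hi
      simp only [wp_flagged, wp_bind, wp_ite, wp_pure, wp_increment, wp_get, wp_putAt, h7]
      by_cases hE : ∃ b < i, E i b
      · rw [if_neg (by simpa [h7] using hE)]
        obtain ⟨b, hb, hEb⟩ := hE
        have h9 := h8 b hb hEb
        refine ⟨⟨hF₂, by omega, by omega, fun a ha a' ha' => ?_, fun c => ?_⟩, by omega⟩
        · have key : ∀ a < i, (M₁ .locCol a 0 = M₁ .locCol b 0 ↔ E a i) := fun a ha =>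
            (h3 a ha b hb).trans ⟨fun h => htrans _ _ _ h (hsymm _ _ hEb),
              fun h => htrans _ _ _ h hEb⟩
          rcases Nat.lt_succ_iff_lt_or_eq.1 ha with ha | rfl <;>
            rcases Nat.lt_succ_iff_lt_or_eq.1 ha' with ha' | rfl
          · rw [h6 a ha, h6 a' ha', h3 a ha a' ha']
          · rw [h6 a ha, h9, key a ha]
          · rw [h6 a' ha', h9, eq_comm, key a' ha']
            exact ⟨hsymm _ _, hsymm _ _⟩
          · simp [hii]
        · rw [h5, ← h4 c]
          constructor
          · rintro ⟨a, ha, rfl⟩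
            rcases Nat.lt_succ_iff_lt_or_eq.1 ha with ha | rfl
            exacts [⟨a, ha, h6 a ha⟩, ⟨b, hb, h9⟩]
          · rintro ⟨a, ha, rfl⟩
            exact ⟨a, by omega, (h6 a ha).symm⟩
      · rw [if_pos (by simpa [h7] using hE)]
        push Not at hE
        set M₃ := (M₂.set .numCol 0 0 (M₂ .numCol 0 0 + 1)) with hM₃
        have e1 : (M₃.set .locCol i 0 (M₃ .numCol 0 0)) .numCol 0 0 = M₁ .numCol 0 0 + 1 := by
          simp [hM₃, Mem.set, h5]
        have e2 : (M₃.set .locCol i 0 (M₃ .numCol 0 0)) .locCol i 0 = M₁ .numCol 0 0 + 1 := by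
          simp [hM₃, Mem.set, h5]
        have e3 : ∀ a < i, (M₃.set .locCol i 0 (M₃ .numCol 0 0)) .locCol a 0 =
            M₁ .locCol a 0 := fun a ha => by
          simp [hM₃, Mem.set, h6 a ha, ha.ne]
        have hlt : ∀ a < i, N < M₁ .locCol a 0 ∧ M₁ .locCol a 0 ≤ M₁ .numCol 0 0 := fun a ha =>
          (h4 _).1 ⟨a, ha, rfl⟩
        refine ⟨⟨(hF₂.set (by decide) _ _ _).set (by decide) _ _ _, by omega, by omega,
          fun a ha a' ha' => ?_, fun c => ?_⟩, by omega⟩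
        · rcases Nat.lt_succ_iff_lt_or_eq.1 ha with ha | rfl <;>
            rcases Nat.lt_succ_iff_lt_or_eq.1 ha' with ha' | rfl
          · rw [e3 a ha, e3 a' ha', h3 a ha a' ha']
          · rw [e3 a ha, e2]
            have := hlt a ha
            exact ⟨fun h => by omega, fun h => absurd (hsymm _ _ h) (hE a ha)⟩
          · rw [e3 a' ha', e2]
            have := hlt a' ha'
            exact ⟨fun h => by omega, fun h => absurd h (hE a' ha')⟩
          · simp [hii]
        · rw [e1]
          constructor
          · rintro ⟨a, ha, rfl⟩
            rcases Nat.lt_succ_iff_lt_or_eq.1 ha with ha | rfl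
            · rw [e3 a ha]
              have := hlt a ha
              omega
            · rw [e2]
              omega
          · rintro ⟨hc, hc'⟩
            rcases Nat.lt_succ_iff_lt_or_eq.1 (Nat.lt_succ_of_le hc') with hc' | rfl
            · obtain ⟨a, ha, rfl⟩ := (h4 c).2 ⟨hc, by omega⟩
              exact ⟨a, by omega, (e3 a ha).symm⟩
            · exact ⟨i, by omega, e2.symm⟩
  · rintro M₁ s ⟨hF, h1, h2, h3, h4⟩ hs
    refine ⟨⟨hF, h1, by omega, h3, h4⟩, ?_⟩
    have e := loop_le (c := 37) (j := 1) hD hdv (by rw [pow_one])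
    have := Nat.one_le_pow 2 D hD
    norm_num at e
    omega

end Local

/-! ## Colouring edges -/

/-- The colours `x` and `y` are adjacent in the colour graph. -/
def Joined (M : Mem) (x y : ℕ) : Prop := ∃ j < M .gLen x 0, M .gNbr x j = y

/-- Memory after appending `y` to the adjacency list of the colour `x`. -/
def Mem.join (M : Mem) (x y : ℕ) : Mem :=
  (M.set .gNbr x (M .gLen x 0) y).set .gLen x 0 (M .gLen x 0 + 1)

theorem joined_join {M : Mem} {x y u w : ℕ} :
    Joined (M.join x y) u w ↔ Joined M u w ∨ (u = x ∧ w = y) := by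
  by_cases hu : u = x
  · subst hu
    simp only [Joined, Mem.join, Mem.set, reduceCtorEq, false_and, if_false, and_self, if_true,
      true_and, Nat.exists_lt_succ_right]
    have : ∀ j < M .gLen u 0, j ≠ M .gLen u 0 := fun j hj => hj.ne
    grind
  · simp [Joined, Mem.join, Mem.set, hu]

/-- The total length of the adjacency lists governs the cost of the search; it grows by at most one
(not at all if x is outside the range). -/
theorem sum_gLen_join (M : Mem) (x y K : ℕ) :
    ∑ c ∈ Finset.range K, (M.join x y) .gLen c 0 ≤ ∑ c ∈ Finset.range K, M .gLen c 0 + 1 := by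
  have : ∀ c, (M.join x y) .gLen c 0 = M .gLen c 0 + if c = x then 1 else 0 := fun c => by
    simp only [Mem.join, Mem.set]
    split <;> simp_all
  simp only [this, Finset.sum_add_distrib, Finset.sum_ite_eq']
  split <;> omega

/-- Appending a new item keeps an output list free of repetitions. -/
theorem bijOn_Iio_succ {α : Type*} {f g : ℕ → α} {m : ℕ} {s : Set α} {x : α}
    (h : Set.BijOn f (Set.Iio m) s) (hg : ∀ i < m, g i = f i) (hx : g m = x) (hxs : x ∉ s) :
    Set.BijOn g (Set.Iio (m + 1)) (insert x s) := by
  have h' : Set.BijOn g (Set.Iio m) s := h.congr fun i hi => (hg i hi).symm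
  have : Set.Iio (m + 1) = insert m (Set.Iio m) := by
    ext i
    simp only [Set.mem_Iio, Set.mem_insert_iff]
    omega
  rw [this, ← hx]
  exact h'.insert (by rwa [hx])

section Paint

variable {V : Type*} {n : ℕ}

/-- The arrays that hold the coloured edges, the output subgraph and the colour graph. -/
def paintArrs : List Arr := [.col, .eFst, .eSnd, .eLen, .seen, .vLen, .vList, .gLen, .gNbr]

/-- The vertices put out so far are those in `X`. -/
def VertsOut (num : V ≃ Fin n) (X : Set V) (M : Mem) : Prop :=
  (∀ x, M .seen (code num x) 0 = 1 ↔ x ∈ X) ∧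
    Set.BijOn (fun i => M .vList i 0) (Set.Iio (M .vLen 0 0)) (code num '' X)

/-- The edges put out so far are those in `Y`. -/
def EdgesOut (num : V ≃ Fin n) (Y : Set (Sym2 V)) (M : Mem) : Prop :=
  Set.BijOn (outEdge M) (Set.Iio (M .eLen 0 0)) (Sym2.map (code num) '' Y)

/-- The current colours record the relation `P`, where `P e c` means that the edge `e` has been
given the colour `c` at some time; at most `T` times an edge has been given a colour. -/
structure Painted (num : V ≃ Fin n) (P : Sym2 V → ℕ → Prop) (T : ℕ) (M : Mem) : Prop where
  col_symm : ∀ a b, M .col (code num a) (code num b) = M .col (code num b) (code num a)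
  col_zero : ∀ a b c, M .col (code num a) (code num b) = 0 → ¬ P s(a, b) c
  col_mem : ∀ a b, M .col (code num a) (code num b) ≠ 0 →
    P s(a, b) (M .col (code num a) (code num b))
  conn : ∀ a b c, P s(a, b) c →
    Relation.ReflTransGen (Joined M) c (M .col (code num a) (code num b))
  joined_symm : ∀ x y, Joined M x y → Joined M y x
  joined_mem : ∀ x y, Joined M x y → ∃ e, P e x ∧ P e y
  sum_le : ∀ K, ∑ c ∈ Finset.range K, M .gLen c 0 ≤ 2 * T
  len_le : M .eLen 0 0 ≤ T
  verts : VertsOut num {x | ∃ e, (∃ c, P e c) ∧ x ∈ e} M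
  edges : EdgesOut num {e | ∃ c, P e c} M

variable {num : V ≃ Fin n} {M M' : Mem}

theorem Painted.congr {P P' : Sym2 V → ℕ → Prop} {T T' : ℕ} (h : Painted num P T M)
    (hP : ∀ e c, P' e c ↔ P e c) (hT : T ≤ T') : Painted num P' T' M := by
  obtain rfl : P = P' := by
    funext e c
    exact propext (hP e c).symm
  exact { h with
    sum_le := fun K => (h.sum_le K).trans (by omega)
    len_le := h.len_le.trans hT }

theorem VertsOut.frame {X : Set V} {S : List Arr} (h : VertsOut num X M) (hF : Frame S M M')
    (h1 : Arr.seen ∉ S := by decide) (h2 : Arr.vList ∉ S := by decide)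
    (h3 : Arr.vLen ∉ S := by decide) : VertsOut num X M' := by
  rwa [VertsOut, hF _ h1, hF _ h2, hF _ h3]

theorem EdgesOut.frame {Y : Set (Sym2 V)} {S : List Arr} (h : EdgesOut num Y M)
    (hF : Frame S M M') (h1 : Arr.eFst ∉ S := by decide) (h2 : Arr.eSnd ∉ S := by decide)
    (h3 : Arr.eLen ∉ S := by decide) : EdgesOut num Y M' := by
  have : outEdge M' = outEdge M := by
    funext i
    simp only [outEdge, hF _ h1, hF _ h2]
  rwa [EdgesOut, this, hF _ h3]

theorem Joined.frame {S : List Arr} {x y : ℕ} (hF : Frame S M M')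
    (h1 : Arr.gLen ∉ S := by decide) (h2 : Arr.gNbr ∉ S := by decide) :
    Joined M' x y ↔ Joined M x y := by
  rw [Joined, hF _ h1, hF _ h2]
  rfl

theorem Painted.frame {P : Sym2 V → ℕ → Prop} {T : ℕ} {S : List Arr} (h : Painted num P T M)
    (hF : Frame S M M') (hS : ∀ A ∈ paintArrs, A ∉ S := by decide) : Painted num P T M' := by
  have hJ : Joined M' = Joined M := by
    funext x y
    exact propext (Joined.frame hF (hS _ (by decide)) (hS _ (by decide)))
  have hcol := hF .col (hS _ (by decide))
  exact {
    col_symm := by rw [hcol]; exact h.col_symm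
    col_zero := by rw [hcol]; exact h.col_zero
    col_mem := by rw [hcol]; exact h.col_mem
    conn := by rw [hcol, hJ]; exact h.conn
    joined_symm := by rw [hJ]; exact h.joined_symm
    joined_mem := by rw [hJ]; exact h.joined_mem
    sum_le := by rw [hF .gLen (hS _ (by decide))]; exact h.sum_le
    len_le := by rw [hF .eLen (hS _ (by decide))]; exact h.len_le
    verts := h.verts.frame hF (hS _ (by decide)) (hS _ (by decide)) (hS _ (by decide))
    edges := h.edges.frame hF (hS _ (by decide)) (hS _ (by decide)) (hS _ (by decide)) }

theorem addVertex_spec {X : Set V} (h : VertsOut num X M) (x : V) :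
    Spec (addVertex (code num x)) M 17 fun _ M' =>
      Frame [.seen, .vLen, .vList] M M' ∧ VertsOut num (insert x X) M' := by
  classical
  obtain ⟨h1, h2⟩ := h
  simp only [addVertex, Spec, wp_bind, wp_zero, wp_flagged, wp_ite, wp_setFlag, wp_get, wp_putAt,
    wp_increment, wp_pure, h1]
  by_cases hx : x ∈ X
  · rw [if_neg (by simpa using hx), Set.insert_eq_of_mem hx]
    exact ⟨⟨.refl _ _, h1, h2⟩, by omega⟩
  · rw [if_pos (by simpa using hx)]
    refine ⟨⟨(((Frame.refl _ _).set (by decide) _ _ _).set (by decide) _ _ _).set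
      (by decide) _ _ _, fun y => ?_, ?_⟩, by omega⟩
    · by_cases hy : y = x
      · simp [Mem.set, hy]
      · simp [Mem.set, hy, h1]
    · rw [Set.image_insert_eq]
      have e : ∀ M' : Mem, (M'.set .vLen 0 0 (M' .vLen 0 0 + 1)) .vLen 0 0 = M' .vLen 0 0 + 1 :=
        fun M' => by simp [Mem.set]
      rw [e]
      refine bijOn_Iio_succ h2 (fun i (hi : i < M .vLen 0 0) => ?_) ?_ ?_
      · simp [Mem.set, hi.ne]
      · simp [Mem.set]
      · simpa using hx

/-- Both stores of the new colour. -/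
theorem col_set_set (a b u w : V) (y : ℕ) :
    ((M.set .col (code num a) (code num b) y).set .col (code num b) (code num a) y) .col
        (code num u) (code num w) = y ∧ s(u, w) = s(a, b) ∨
      ((M.set .col (code num a) (code num b) y).set .col (code num b) (code num a) y) .col
        (code num u) (code num w) = M .col (code num u) (code num w) ∧ s(u, w) ≠ s(a, b) := by
  classical
  simp only [Mem.set_self, code_inj, Sym2.eq_iff, ne_eq]
  split
  · tauto
  · split
    · tauto
    · tauto

/-- A fresh edge leaves the colour graph unchanged and extends the output. Otherwise the old colour
x and y are joined: all earlier colours of the edge were connected to x and are now connected to y,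
and the painted edge itself witnesses that x and y have met. The colour must be nonzero since 0
stands for "not coloured". -/
theorem paint_spec {P : Sym2 V → ℕ → Prop} {T : ℕ} (h : Painted num P T M) (a b : V) {y : ℕ}
    (hy : y ≠ 0) :
    Spec (paint (code num a) (code num b) y) M 50 fun _ M' => Frame paintArrs M M' ∧
      Painted num (fun e c => P e c ∨ e = s(a, b) ∧ c = y) (T + 1) M' := by
  simp only [paint, Spec, wp_bind, wp_load, wp_zero, wp_eq, wp_ite, wp_get, wp_putAt,
    wp_increment, wp_pushRow, wp_store, decide_eq_true_eq]
  set x := M .col (code num a) (code num b) with hx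
  have hvert : insert b (insert a {x | ∃ e, (∃ c, P e c) ∧ x ∈ e}) =
      {x | ∃ e, (∃ c, P e c ∨ e = s(a, b) ∧ c = y) ∧ x ∈ e} := by
    ext z
    simp only [Set.mem_insert_iff, Set.mem_ofPred_eq]
    constructor
    · rintro (rfl | rfl | ⟨e, ⟨c, hc⟩, hz⟩)
      · exact ⟨_, ⟨y, .inr ⟨rfl, rfl⟩⟩, Sym2.mem_mk_right _ _⟩
      · exact ⟨_, ⟨y, .inr ⟨rfl, rfl⟩⟩, Sym2.mem_mk_left _ _⟩
      · exact ⟨e, ⟨c, .inl hc⟩, hz⟩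
    · rintro ⟨e, ⟨c, hc | ⟨rfl, rfl⟩⟩, hz⟩
      · exact .inr (.inr ⟨e, ⟨c, hc⟩, hz⟩)
      · rcases Sym2.mem_iff.1 hz with rfl | rfl <;> simp
  have hedge : insert s(a, b) {e | ∃ c, P e c} = {e | ∃ c, P e c ∨ e = s(a, b) ∧ c = y} := by
    ext e
    simp only [Set.mem_insert_iff, Set.mem_ofPred_eq, exists_or, exists_and_left, exists_eq,
      and_true, or_comm]
  split
  · rename_i hx0
    set M₁ := M.set .eFst (M .eLen 0 0) 0 (code num a) with hM₁
    set M₂ := M₁.set .eSnd (M .eLen 0 0) 0 (code num b) with hM₂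
    set M₃ := M₂.set .eLen 0 0 (M₂ .eLen 0 0 + 1) with hM₃
    have hF₃ : Frame [.eFst, .eSnd, .eLen] M M₃ :=
      (((Frame.refl _ _).set (by decide) _ _ _).set (by decide) _ _ _).set (by decide) _ _ _
    have hlen : M₃ .eLen 0 0 = M .eLen 0 0 + 1 := by simp [hM₃, hM₂, hM₁, Mem.set]
    refine (addVertex_spec (h.verts.frame hF₃) a).wp ?_
    rintro - M₄ s₄ ⟨hF₄, h4⟩ hs₄
    refine (addVertex_spec h4 b).wp ?_
    rintro - M₅ s₅ ⟨hF₅, h5⟩ hs₅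
    have hcol : M₅ .col = M .col := by
      rw [hF₅ .col (by decide), hF₄ .col (by decide), hF₃ .col (by decide)]
    set M₆ := (M₅.set .col (code num a) (code num b) y).set .col (code num b) (code num a) y
      with hM₆
    have hF₆ : Frame [.col] M₅ M₆ :=
      ((Frame.refl _ _).set (by decide) _ _ _).set (by decide) _ _ _
    have hF₆' : Frame [.col, .eFst, .eSnd, .eLen, .seen, .vLen, .vList] M M₆ :=
      (hF₃.mono (by decide)).trans ((hF₄.mono (by decide)).trans
        ((hF₅.mono (by decide)).trans (hF₆.mono (by decide))))
    have hJ : Joined M₆ = Joined M := by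
      funext u w
      exact propext (Joined.frame hF₆')
    have hc := fun u w => col_set_set (M := M₅) (num := num) a b u w y
    rw [← hM₆, hcol] at hc
    have hab := h.col_zero a b
    refine ⟨⟨hF₆'.mono (by decide), ?_⟩, by omega⟩
    exact {
      col_symm := fun u w => by
        have h1 := hc u w
        have h2 := hc w u
        rw [Sym2.eq_swap (a := w)] at h2
        have h3 := h.col_symm u w
        grind
      col_zero := fun u w c h0 => by
        rcases hc u w with ⟨h1, h2⟩ | ⟨h1, h2⟩
        · omega
        · rw [h1] at h0
          have := h.col_zero u w c h0
          tauto
      col_mem := fun u w h0 => by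
        rcases hc u w with ⟨h1, h2⟩ | ⟨h1, h2⟩
        · exact .inr ⟨h2, h1⟩
        · rw [h1] at h0 ⊢
          exact .inl (h.col_mem u w h0)
      conn := fun u w c hP => by
        rw [hJ]
        rcases hc u w with ⟨h1, h2⟩ | ⟨h1, h2⟩
        · rcases hP with hP | ⟨-, rfl⟩
          · rw [h2] at hP
            exact absurd hP (hab c hx0)
          · rw [h1]
        · rcases hP with hP | ⟨hP, -⟩
          · rw [h1]
            exact h.conn u w c hP
          · exact absurd hP h2
      joined_symm := by rw [hJ]; exact h.joined_symm
      joined_mem := fun u w hj => by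
        rw [hJ] at hj
        obtain ⟨e, h1, h2⟩ := h.joined_mem u w hj
        exact ⟨e, .inl h1, .inl h2⟩
      sum_le := fun K => by
        rw [hF₆' .gLen (by decide)]
        exact (h.sum_le K).trans (by omega)
      len_le := by
        rw [hF₆ .eLen (by decide), hF₅ .eLen (by decide), hF₄ .eLen (by decide), hlen]
        exact Nat.succ_le_succ h.len_le
      verts := by
        rw [← hvert]
        exact h5.frame hF₆
      edges := by
        have hne : Sym2.map (code num) s(a, b) ∉ Sym2.map (code num) '' {e | ∃ c, P e c} := by
          rintro ⟨e, ⟨c, he⟩, heq⟩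
          have hinj : Function.Injective (code num) := fun u w => (code_inj num).1
          rw [Sym2.map.injective hinj heq] at he
          exact hab c hx0 he
        have h3 : EdgesOut num {e | ∃ c, P e c ∨ e = s(a, b) ∧ c = y} M₃ := by
          rw [← hedge, EdgesOut, Set.image_insert_eq]
          rw [hlen]
          refine bijOn_Iio_succ h.edges (fun i hi => ?_) ?_ hne
          · simp [outEdge, hM₃, hM₂, hM₁, Mem.set, hi.ne]
          · simp [outEdge, hM₃, hM₂, hM₁, Mem.set]
        exact h3.frame (S := [.col, .seen, .vLen, .vList]) ((hF₄.mono (by decide)).trans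
          ((hF₅.mono (by decide)).trans (hF₆.mono (by decide)))) }
  · rename_i hx0
    change _ ∧ _
    set M₁ := (M.join x y).join y x with hM₁
    have hF₁ : Frame [.gLen, .gNbr] M M₁ :=
      ((((Frame.refl _ _).set (by decide) _ _ _).set (by decide) _ _ _).set
        (by decide) _ _ _).set (by decide) _ _ _
    set M₂ := (M₁.set .col (code num a) (code num b) y).set .col (code num b) (code num a) y
      with hM₂
    have hF₂ : Frame [.col] M₁ M₂ :=
      ((Frame.refl _ _).set (by decide) _ _ _).set (by decide) _ _ _
    have hF : Frame [.col, .gLen, .gNbr] M M₂ :=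
      (hF₁.mono (by decide)).trans (hF₂.mono (by decide))
    change (Frame paintArrs M M₂ ∧ Painted _ _ _ M₂) ∧ _
    have hJ : ∀ u w, Joined M₂ u w ↔ Joined M u w ∨ u = x ∧ w = y ∨ u = y ∧ w = x := by
      intro u w
      rw [Joined.frame hF₂, hM₁, joined_join, joined_join, or_assoc]
    have hle : ∀ u w, Joined M u w → Joined M₂ u w := fun u w h => (hJ u w).2 (.inl h)
    have hc := fun u w => col_set_set (M := M₁) (num := num) a b u w y
    rw [← hM₂, hF₁ .col (by decide)] at hc
    have hPx : P s(a, b) x := h.col_mem a b hx0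
    refine ⟨⟨hF.mono (by decide), ?_⟩, by omega⟩
    -- The edge already had a colour, so neither the edges nor the vertices of the output change.
    have hedge' : {e | ∃ c, P e c ∨ e = s(a, b) ∧ c = y} = {e | ∃ c, P e c} := by
      rw [← hedge]
      exact Set.insert_eq_of_mem ⟨x, hPx⟩
    exact {
      col_symm := fun u w => by
        have h1 := hc u w
        have h2 := hc w u
        rw [Sym2.eq_swap (a := w)] at h2
        have h3 := h.col_symm u w
        grind
      col_zero := fun u w c h0 => by
        rcases hc u w with ⟨h1, h2⟩ | ⟨h1, h2⟩
        · omega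
        · rw [h1] at h0
          have := h.col_zero u w c h0
          tauto
      col_mem := fun u w h0 => by
        rcases hc u w with ⟨h1, h2⟩ | ⟨h1, h2⟩
        · exact .inr ⟨h2, h1⟩
        · rw [h1] at h0 ⊢
          exact .inl (h.col_mem u w h0)
      conn := fun u w c hP => by
        rcases hc u w with ⟨h1, h2⟩ | ⟨h1, h2⟩
        · rw [h1]
          rcases hP with hP | ⟨-, rfl⟩
          · rw [h2] at hP
            exact (Relation.ReflTransGen.mono hle _ _ (h.conn a b c hP)).tail ((hJ x y).2 (.inr (.inl ⟨rfl, rfl⟩)))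
          · exact .refl
        · rcases hP with hP | ⟨hP, -⟩
          · rw [h1]
            exact Relation.ReflTransGen.mono hle _ _ (h.conn u w c hP)
          · exact absurd hP h2
      joined_symm := fun u w => by
        rw [hJ, hJ]
        have := h.joined_symm u w
        tauto
      joined_mem := fun u w => by
        rw [hJ]
        rintro (hj | ⟨rfl, rfl⟩ | ⟨rfl, rfl⟩)
        · obtain ⟨e, h1, h2⟩ := h.joined_mem u w hj
          exact ⟨e, .inl h1, .inl h2⟩
        · exact ⟨s(a, b), .inl hPx, .inr ⟨rfl, rfl⟩⟩
        · exact ⟨s(a, b), .inr ⟨rfl, rfl⟩, .inl hPx⟩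
      sum_le := fun K => by
        rw [hF₂ .gLen (by decide)]
        have h1 := sum_gLen_join (M.join x y) y x K
        rw [← hM₁] at h1
        have h2 := sum_gLen_join M x y K
        have h3 := h.sum_le K
        omega
      len_le := by
        rw [hF .eLen (by decide)]
        exact h.len_le.trans (Nat.le_succ T)
      verts := by
        have : {x | ∃ e, (∃ c, P e c ∨ e = s(a, b) ∧ c = y) ∧ x ∈ e} =
            {x | ∃ e, (∃ c, P e c) ∧ x ∈ e} := by
          ext z
          have := fun e => Set.ext_iff.1 hedge' e
          simp only [Set.mem_ofPred_eq] at this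
          simp only [Set.mem_ofPred_eq, this]
        rw [this]
        exact h.verts.frame hF
      edges := by
        rw [hedge']
        exact h.edges.frame hF }

/-- One rule for the nested painting loops: relations add up as unions and paint operations as at
most `τ` per round. The frame refers to the fixed memory `M₀`, whose local tables the bodies read
and painting never alters. -/
theorem paintLoop_spec {M₀ : Mem} {m t τ : ℕ} {body : ℕ → Prog ℕ Unit}
    {Q : ℕ → Sym2 V → ℕ → Prop}
    (hbody : ∀ i < m, ∀ P T M, Frame paintArrs M₀ M → Painted num P T M →
      Spec (body i) M t fun _ M' => Frame paintArrs M₀ M' ∧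
        Painted num (fun e c => P e c ∨ Q i e c) (T + τ) M')
    (P : Sym2 V → ℕ → Prop) (T : ℕ) (M : Mem) (hF : Frame paintArrs M₀ M)
    (h : Painted num P T M) :
    Spec (.forLoop m body) M (m * (t + 1) + 1) fun _ M' => Frame paintArrs M₀ M' ∧
      Painted num (fun e c => P e c ∨ ∃ i < m, Q i e c) (T + m * τ) M' := by
  refine wp_forLoop (fun i M' => Frame paintArrs M₀ M' ∧
    Painted num (fun e c => P e c ∨ ∃ j < i, Q j e c) (T + i * τ) M') t
    ⟨hF, h.congr (by simp) (by omega)⟩ ?_ fun M' s h hs => ⟨h, by omega⟩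
  rintro i hi M₁ ⟨hF₁, h1⟩
  refine (hbody i hi _ _ _ hF₁ h1).wp ?_
  rintro - M₂ s ⟨hF₂, h2⟩ hs
  refine ⟨⟨hF₂, h2.congr (fun e c => ?_) ?_⟩, by omega⟩
  · rw [Nat.exists_lt_succ_right, or_assoc]
  · rw [Nat.succ_mul]
    omega

end Paint

/-! ### Colouring one partial star product -/

section ColourPSP

variable {V : Type*} {n : ℕ} [Fintype V] {G : SimpleGraph V} [DecidableRel G.Adj] {num : V ≃ Fin n}
  {nb : V → ℕ → V} {D : ℕ} {M : Mem}

/-- At most D paint operations for the edges at v and D · D · D for the others, hence the bound 2D³.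
-/
theorem colourPSP_spec (hM : Static G num nb D M) (v : V) {P : Sym2 V → ℕ → Prop} {T : ℕ}
    (h : Painted num P T M) (hcol : ∀ i < G.degree v, M .locCol i 0 ≠ 0)
    (hloc : ∀ i < G.degree v, ∀ k < G.degree v,
      M .loc i k = 1 ↔ localRelStar G v s(v, nb v i) s(v, nb v k)) :
    Spec (colourPSP (code num v)) M (200 * D ^ 3) fun _ M' => Frame paintArrs M M' ∧
      Painted num (fun e c => P e c ∨ ∃ i < G.degree v, c = M .locCol i 0 ∧
        OwnEdge G v (nb v) (G.degree v) i e) (T + 2 * D ^ 3) M' := by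
  classical
  have hD := hM.pos
  have hdv := hM.deg_le v
  have hD1 := pow_le_pow_succ' hD 1
  have hD2 := pow_le_pow_succ' hD 2
  norm_num at hD1 hD2
  simp only [colourPSP, Spec, wp_bind, wp_getAt]
  rw [hM.deg]
  set d := G.degree v with hd
  refine (paintLoop_spec (num := num) (M₀ := M) (t := 53) (τ := 1)
    (Q := fun i e c => e = s(v, nb v i) ∧ c = M .locCol i 0) ?_ P T M (.refl _ _) h).wp ?_
  · intro i hi P T M₁ hF h
    have hS := hM.frame (S := paintArrs) hF
    simp only [Spec, wp_bind, wp_load, wp_getAt]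
    rw [hS.nbr v i hi, hF .locCol (by decide)]
    refine (paint_spec h v (nb v i) (hcol i hi)).wp ?_
    rintro - M₂ s ⟨hF₂, h2⟩ hs
    exact ⟨⟨hF.trans hF₂, h2⟩, by omega⟩
  rintro - M₁ s₁ ⟨hF₁, h1⟩ hs₁
  let B : ℕ → ℕ → ℕ → Sym2 V → ℕ → Prop := fun i k l e c =>
    ¬ localRelStar G v s(v, nb v i) s(v, nb v k) ∧ G.Adj (nb (nb v i) l) (nb v k) ∧
      nb (nb v i) l ≠ v ∧ e = s(nb v i, nb (nb v i) l) ∧ c = M .locCol k 0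
  refine (paintLoop_spec (num := num) (M₀ := M) (t := 72 * D ^ 2) (τ := D * D)
    (Q := fun i e c => ∃ k < d, ∃ l < G.degree (nb v i), B i k l e c) ?_ _ _ M₁ hF₁ h1).wp ?_
  · intro i hi P T M₂ hF₂ h2
    have hS₂ := hM.frame (S := paintArrs) hF₂
    simp only [Spec, wp_bind, wp_load, wp_getAt]
    rw [hS₂.nbr v i hi, hS₂.deg]
    refine (paintLoop_spec (num := num) (M₀ := M) (t := 67 * D) (τ := D)
      (Q := fun k e c => ∃ l < G.degree (nb v i), B i k l e c) ?_ _ _ M₂ hF₂ h2).wp ?_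
    · intro k hk P T M₃ hF₃ h3
      have hS₃ := hM.frame (S := paintArrs) hF₃
      simp only [Spec, wp_bind, wp_flagged, wp_ite, wp_pure]
      rw [hF₃ .loc (by decide)]
      simp only [hloc i hi k hk]
      by_cases hE : localRelStar G v s(v, nb v i) s(v, nb v k)
      · rw [if_neg (by simpa using hE)]
        exact ⟨⟨hF₃, h3.congr (by simp [B, hE]) (by omega)⟩, by omega⟩
      · rw [if_pos (by simpa using hE)]
        simp only [wp_load, wp_getAt]
        rw [hS₃.nbr v k hk, hF₃ .locCol (by decide)]
        refine (paintLoop_spec (num := num) (M₀ := M) (t := 56) (τ := 1)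
          (Q := fun l e c => B i k l e c) ?_ _ _ M₃ hF₃ h3).wp ?_
        · intro l hl P T M₄ hF₄ h4
          have hS₄ := hM.frame (S := paintArrs) hF₄
          simp only [Spec, wp_bind, wp_load, wp_eq, wp_flagged, wp_ite, wp_pure]
          rw [hS₄.nbr _ l hl]
          simp only [hS₄.adj, code_inj]
          by_cases hA : G.Adj (nb (nb v i) l) (nb v k) ∧ nb (nb v i) l ≠ v
          · rw [if_pos (by simpa using hA)]
            refine (paint_spec h4 (nb v i) _ (hcol k hk)).wp ?_
            rintro - M₅ s₅ ⟨hF₅, h5⟩ hs₅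
            exact ⟨⟨hF₄.trans hF₅, h5.congr (fun e c => by simp [B, hE, hA.1, hA.2]) le_rfl⟩,
              by omega⟩
          · rw [if_neg (by simpa using hA)]
            refine ⟨⟨hF₄, h4.congr (fun e c => ?_) (by omega)⟩, by omega⟩
            simp only [B]
            tauto
        · rintro - M₄ s₄ ⟨hF₄, h4⟩ hs₄
          have := hM.deg_le (nb v i)
          exact ⟨⟨hF₄, h4.congr (fun e c => Iff.rfl) (by omega)⟩, by omega⟩
    · rintro - M₃ s₃ ⟨hF₃, h3⟩ hs₃
      refine ⟨⟨hF₃, h3.congr (fun e c => Iff.rfl) ?_⟩, ?_⟩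
      · have := Nat.mul_le_mul hdv (le_refl D)
        omega
      · have e := loop_le (c := 67) (j := 1) hD hdv (t := 67 * D) (by rw [pow_one])
        norm_num at e
        omega
  · rintro - M₂ s₂ ⟨hF₂, h2⟩ hs₂
    refine ⟨⟨hF₂, h2.congr (fun e c => ?_) ?_⟩, ?_⟩
    · rw [or_assoc]
      refine or_congr Iff.rfl ?_
      -- The indices change roles: in `OwnEdge` the index i gives the colour, while in the program
      -- the outer index runs over the neighbour at which the edge is attached and the inner one
      -- gives the colour.
      constructor
      · rintro ⟨i, hi, rfl, rfl | ⟨k, hk, hn, x, h3, h4, h5, rfl⟩⟩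
        · exact .inl ⟨i, hi, rfl, rfl⟩
        · obtain ⟨l, hl, rfl⟩ := hM.exists_nb h3
          exact .inr ⟨k, hk, i, hi, l, hl, hn, h4, h5, rfl, rfl⟩
      · rintro (⟨i, hi, rfl, rfl⟩ | ⟨k, hk, i, hi, l, hl, hn, h4, h5, rfl, rfl⟩)
        · exact ⟨i, hi, rfl, .inl rfl⟩
        · exact ⟨i, hi, rfl, .inr ⟨k, hk, hn, _, hM.adj_nb hl, h4, h5, rfl⟩⟩
    · have : d * (D * D) ≤ D ^ 3 := by
        calc d * (D * D) ≤ D * (D * D) := Nat.mul_le_mul hdv le_rfl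
          _ = D ^ 3 := by ring
      omega
    · have e := loop_le (c := 72) (j := 2) hD hdv le_rfl
      norm_num at e
      omega

end ColourPSP

/-! ## Connected components of the colour graph -/

section Components

open Relation (ReflTransGen)

variable {J : ℕ → ℕ → Prop} {N H K : ℕ} {M M' : Mem}

/-- State of the breadth-first search in the graph `J` with vertices `1, …, N`: the first `H`
colours in the queue have been processed, and `K` components have been found. -/
structure Search (J : ℕ → ℕ → Prop) (N H K : ℕ) (M : Mem) : Prop where
  head_le : H ≤ M .qTail 0 0
  inj : ∀ i < M .qTail 0 0, ∀ j < M .qTail 0 0, M .queue i 0 = M .queue j 0 → i = j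
  range : ∀ j < M .qTail 0 0, 1 ≤ M .queue j 0 ∧ M .queue j 0 ≤ N
  comp_iff : ∀ c, M .comp c 0 ≠ 0 ↔ ∃ j < M .qTail 0 0, M .queue j 0 = c
  closed : ∀ j < H, ∀ y, J (M .queue j 0) y → M .comp y 0 = M .comp (M .queue j 0) 0
  current : ∀ j, H ≤ j → j < M .qTail 0 0 → M .comp (M .queue j 0) 0 = K
  comp_le : ∀ c, M .comp c 0 ≤ K
  conn : ∀ c c', M .comp c 0 = M .comp c' 0 → M .comp c 0 ≠ 0 → ReflTransGen J c c'
  surj : ∀ k, 1 ≤ k → k ≤ K → ∃ c, M .comp c 0 = k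

/-- `M'` is a later state of the search than `M`. -/
structure Grows (M M' : Mem) : Prop where
  comp : ∀ c, M .comp c 0 ≠ 0 → M' .comp c 0 = M .comp c 0
  tail : M .qTail 0 0 ≤ M' .qTail 0 0
  queue : ∀ j < M .qTail 0 0, M' .queue j 0 = M .queue j 0

theorem Grows.refl (M : Mem) : Grows M M := ⟨fun _ _ => rfl, le_rfl, fun _ _ => rfl⟩

theorem Grows.trans {M'' : Mem} (h : Grows M M') (h' : Grows M' M'') : Grows M M'' where
  comp c hc := by rw [h'.comp c (by rwa [h.comp c hc]), h.comp c hc]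
  tail := h.tail.trans h'.tail
  queue j hj := by rw [h'.queue j (hj.trans_le h.tail), h.queue j hj]

theorem Search.frame {S : List Arr} (h : Search J N H K M) (hF : Frame S M M')
    (h1 : Arr.comp ∉ S := by decide) (h2 : Arr.queue ∉ S := by decide)
    (h3 : Arr.qTail ∉ S := by decide) : Search J N H K M' := by
  constructor
  all_goals try rw [hF _ h3]
  all_goals try rw [hF _ h1]
  all_goals try rw [hF _ h2]
  exacts [h.head_le, h.inj, h.range, h.comp_iff, h.closed, h.current, h.comp_le, h.conn, h.surj]

theorem Grows.of_frame {S : List Arr} (hF : Frame S M M')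
    (h1 : Arr.comp ∉ S := by decide) (h2 : Arr.queue ∉ S := by decide)
    (h3 : Arr.qTail ∉ S := by decide) : Grows M M' :=
  ⟨fun _ _ => by rw [hF _ h1], by rw [hF _ h3], fun _ _ => by rw [hF _ h2]⟩

/-- Serves two situations: the component counter equals K when the current component is extended,
and K + 1 when a new one is started. In the latter case `hconn` and `hcur` are vacuous, since no
colour has the new label yet and the queue is empty. -/
theorem visit_spec (hJ : ∀ x y, J x y → J y x) (h : Search J N H K M) {c : ℕ}
    (hc0 : M .comp c 0 = 0) (hc : 1 ≤ c ∧ c ≤ N) (hK1 : 1 ≤ M .numComp 0 0)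
    (hK : K ≤ M .numComp 0 0) (hK' : M .numComp 0 0 ≤ K + 1)
    (hconn : ∀ c', M .comp c' 0 = M .numComp 0 0 → ReflTransGen J c' c)
    (hcur : ∀ j, H ≤ j → j < M .qTail 0 0 → M .comp (M .queue j 0) 0 = M .numComp 0 0) :
    Spec (visit c) M 13 fun _ M' => Frame [.comp, .queue, .qTail] M M' ∧
      Search J N H (M .numComp 0 0) M' ∧ Grows M M' ∧ M' .comp c 0 = M .numComp 0 0 ∧
      M' .qTail 0 0 = M .qTail 0 0 + 1 := by
  simp only [visit, Spec, wp_bind, wp_get, wp_putAt, wp_increment]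
  set K' := M .numComp 0 0 with hK'def
  set M₁ := M.set .comp c 0 K' with hM₁
  set M₂ := M₁.set .queue (M₁ .qTail 0 0) 0 c with hM₂
  set M₃ := M₂.set .qTail 0 0 (M₂ .qTail 0 0 + 1) with hM₃
  have hF : Frame [.comp, .queue, .qTail] M M₃ :=
    (((Frame.refl _ _).set (by decide) _ _ _).set (by decide) _ _ _).set (by decide) _ _ _
  have htail : M₃ .qTail 0 0 = M .qTail 0 0 + 1 := by simp [hM₃, hM₂, hM₁, Mem.set]
  have hcomp : ∀ x, M₃ .comp x 0 = if x = c then K' else M .comp x 0 := fun x => by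
    simp [hM₃, hM₂, hM₁, Mem.set]
  have hqueue : ∀ j < M .qTail 0 0, M₃ .queue j 0 = M .queue j 0 := fun j hj => by
    simp [hM₃, hM₂, hM₁, Mem.set, hj.ne]
  have hlast : M₃ .queue (M .qTail 0 0) 0 = c := by simp [hM₃, hM₂, hM₁, Mem.set]
  have hcc : M₃ .comp c 0 = K' := by rw [hcomp, if_pos rfl]
  have hne : ∀ x, M .comp x 0 ≠ 0 → M₃ .comp x 0 = M .comp x 0 := fun x hx => by
    rw [hcomp, if_neg]
    rintro rfl
    exact hx hc0
  have hq : ∀ j < M .qTail 0 0, M .comp (M .queue j 0) 0 ≠ 0 := fun j hj =>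
    (h.comp_iff _).2 ⟨j, hj, rfl⟩
  have hqc : ∀ j < M .qTail 0 0, M .queue j 0 ≠ c := fun j hj e => hq j hj (e ▸ hc0)
  have hswap : ∀ {x y}, ReflTransGen J x y → ReflTransGen J y x := fun {x y} hxy => by
    induction hxy with
    | refl => exact .refl
    | tail _ hab ih => exact ih.head (hJ _ _ hab)
  refine ⟨⟨hF, ?_, ⟨hne, by omega, hqueue⟩, hcc, htail⟩, by omega⟩
  constructor
  · have := h.head_le
    omega
  · intro i hi j hj hij
    rw [htail] at hi hj
    rcases Nat.lt_succ_iff_lt_or_eq.1 hi with hi | rfl <;>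
      rcases Nat.lt_succ_iff_lt_or_eq.1 hj with hj | rfl
    · rw [hqueue i hi, hqueue j hj] at hij
      exact h.inj i hi j hj hij
    · rw [hqueue i hi, hlast] at hij
      exact absurd hij (hqc i hi)
    · rw [hqueue j hj, hlast] at hij
      exact absurd hij.symm (hqc j hj)
    · rfl
  · intro j hj
    rw [htail] at hj
    rcases Nat.lt_succ_iff_lt_or_eq.1 hj with hj | rfl
    · rw [hqueue j hj]
      exact h.range j hj
    · rwa [hlast]
  · intro x
    rw [htail, Nat.exists_lt_succ_right, hlast]
    have : (∃ j < M .qTail 0 0, M₃ .queue j 0 = x) ↔ M .comp x 0 ≠ 0 := by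
      rw [h.comp_iff]
      exact exists_congr fun j => and_congr_right fun hj => by rw [hqueue j hj]
    rw [this, hcomp]
    split
    · rename_i hx
      subst hx
      simp only [or_true, iff_true]
      omega
    · rename_i hx
      simp [Ne.symm hx]
  · intro j hj y hy
    have hj' := hj.trans_le h.head_le
    rw [hqueue j hj'] at hy ⊢
    have := h.closed j hj y hy
    rw [hne _ (hq j hj'), hne y (by rw [this]; exact hq j hj'), this]
  · intro j hj hj'
    rw [htail] at hj'
    rcases Nat.lt_succ_iff_lt_or_eq.1 hj' with hj' | rfl
    · rw [hqueue j hj', hne _ (hq j hj'), hcur j hj hj']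
    · rw [hlast, hcc]
  · intro x
    rw [hcomp]
    split
    · exact le_rfl
    · exact (h.comp_le x).trans hK
  · intro x y hxy hx0
    rw [hcomp] at hxy hx0
    rw [hcomp] at hxy
    split at hxy <;> split at hxy
    · simp_all [ReflTransGen.refl]
    · rename_i h1 h2
      rw [h1]
      exact hswap (hconn y hxy.symm)
    · rename_i h1 h2
      rw [h2]
      exact hconn x hxy
    · rename_i h1 h2
      rw [if_neg h1] at hx0
      exact h.conn x y hxy hx0
  · intro k hk hk'
    by_cases hkK : k ≤ K
    · obtain ⟨x, hx⟩ := h.surj k hk hkK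
      exact ⟨x, by rw [hne x (by omega), hx]⟩
    · exact ⟨c, by omega⟩

/-- The cost of processing the first `H` colours in the queue. -/
def searchCost (M : Mem) (H : ℕ) : ℕ :=
  ∑ j ∈ Finset.range H, (20 + 20 * M .gLen (M .queue j 0) 0)

theorem searchCost_congr (hg : M' .gLen = M .gLen) (hM : Grows M M') (hH : H ≤ M .qTail 0 0) :
    searchCost M' H = searchCost M H := by
  refine Finset.sum_congr rfl fun j hj => ?_
  rw [hg, hM.queue j (by have := Finset.mem_range.1 hj; omega)]

theorem Search.image_subset (h : Search J N H K M) :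
    (Finset.range (M .qTail 0 0)).image (fun j => M .queue j 0) ⊆ Finset.Icc 1 N := by
  intro c hc
  obtain ⟨j, hj, rfl⟩ := Finset.mem_image.1 hc
  exact Finset.mem_Icc.2 (h.range j (Finset.mem_range.1 hj))

theorem Search.injOn (h : Search J N H K M) :
    Set.InjOn (fun j => M .queue j 0) (Finset.range (M .qTail 0 0) : Set ℕ) :=
  fun i hi j hj hij => h.inj i (by simpa using hi) j (by simpa using hj) hij

theorem Search.tail_le (h : Search J N H K M) : M .qTail 0 0 ≤ N := by
  have := Finset.card_le_card h.image_subset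
  rwa [Finset.card_image_of_injOn h.injOn, Finset.card_range, Nat.card_Icc,
    Nat.add_sub_cancel] at this

/-- The queue never repeats a colour, so the degrees along it sum to at most the sum over all
colours. -/
theorem Search.cost_le (h : Search J N H K M) :
    searchCost M (M .qTail 0 0) ≤ 20 * N + 20 * ∑ c ∈ Finset.range (N + 1), M .gLen c 0 := by
  have h1 : ∑ j ∈ Finset.range (M .qTail 0 0), M .gLen (M .queue j 0) 0 ≤
      ∑ c ∈ Finset.range (N + 1), M .gLen c 0 := by
    rw [← Finset.sum_image (f := fun c => M .gLen c 0) h.injOn]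
    refine Finset.sum_le_sum_of_subset (h.image_subset.trans fun c hc => ?_)
    have := Finset.mem_Icc.1 hc
    exact Finset.mem_range.2 (by omega)
  have h2 := h.tail_le
  rw [searchCost, Finset.sum_add_distrib, ← Finset.mul_sum]
  simp only [Finset.sum_const, Finset.card_range, smul_eq_mul]
  omega

/-- Processing one colour from the queue. -/
theorem process_spec (hJ : ∀ x y, J x y → J y x) (hJN : ∀ x y, J x y → 1 ≤ y ∧ y ≤ N)
    (h : Search J N H K M) (hH : H < M .qTail 0 0) (hK : M .numComp 0 0 = K) (hK1 : 1 ≤ K)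
    (hJM : ∀ x y, J x y ↔ Joined M x y) :
    Spec (.forLoop (M .gLen (M .queue H 0) 0) fun j => do
        let y ← Prog.load .gNbr (M .queue H 0) j
        let k' ← getAt .comp y
        let new' ← Prog.eq k' 0
        if new' then visit y) M (M .gLen (M .queue H 0) 0 * 18 + 1) fun _ M' =>
      Frame [.comp, .queue, .qTail] M M' ∧ Search J N (H + 1) K M' ∧ Grows M M' := by
  set x := M .queue H 0 with hx
  refine wp_forLoop (fun i M' => Frame [.comp, .queue, .qTail] M M' ∧ Search J N H K M' ∧
    Grows M M' ∧ ∀ j < i, M' .comp (M .gNbr x j) 0 = K) 17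
    ⟨.refl _ _, h, .refl _, by simp⟩ ?_ ?_
  · rintro i hi M₁ ⟨hF, h1, hG, h2⟩
    simp only [Spec, wp_bind, wp_load, wp_getAt, wp_eq, wp_ite, wp_pure, decide_eq_true_eq]
    rw [hF .gNbr (by decide)]
    set y := M .gNbr x i with hy
    have hxy : J x y := (hJM x y).2 ⟨i, hi, rfl⟩
    have hnum : M₁ .numComp 0 0 = K := by rw [hF .numComp (by decide), hK]
    have hH1 : H < M₁ .qTail 0 0 := hH.trans_le hG.tail
    have hxH : M₁ .queue H 0 = x := hG.queue H hH
    have hxK : M₁ .comp x 0 = K := by rw [← hxH]; exact h1.current H le_rfl hH1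
    split
    · rename_i hy0
      refine (visit_spec hJ h1 hy0 (hJN x y hxy) (by omega) (by omega) (by omega) ?_ ?_).wp ?_
      · intro c' hc'
        exact (h1.conn c' x (by omega) (by omega)).tail hxy
      · intro j hj hj'
        rw [h1.current j hj hj', hnum]
      rintro - M₂ s ⟨hF₂, h3, hG₂, h4, -⟩ hs
      rw [hnum] at h3 h4
      refine ⟨⟨hF.trans hF₂, h3, hG.trans hG₂, fun j hj => ?_⟩, by omega⟩
      rcases Nat.lt_succ_iff_lt_or_eq.1 hj with hj | rfl
      · have := h2 j hj
        rw [hG₂.comp _ (by omega), this]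
      · exact h4
    · rename_i hy0
      refine ⟨⟨hF, h1, hG, fun j hj => ?_⟩, by omega⟩
      rcases Nat.lt_succ_iff_lt_or_eq.1 hj with hj | rfl
      · exact h2 j hj
      · rw [← hy]
        -- An already visited neighbour y belongs to the current component: if y has been processed,
        -- closedness and symmetry give it the label of x; otherwise it is waiting in the queue with
        -- the current label.
        obtain ⟨l, hl, hly⟩ := (h1.comp_iff y).1 hy0
        by_cases hlH : l < H
        · have := h1.closed l hlH x (by rw [hly]; exact hJ x y hxy)
          rw [hly] at this
          omega
        · have := h1.current l (by omega) hl
          rwa [hly] at this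
  · rintro M₁ s ⟨hF, h1, hG, h2⟩ hs
    have hH1 : H < M₁ .qTail 0 0 := hH.trans_le hG.tail
    have hxH : M₁ .queue H 0 = x := hG.queue H hH
    refine ⟨⟨hF, { h1 with head_le := hH1, closed := ?_, current := ?_ }, hG⟩, by omega⟩
    · intro j hj y hy
      rcases Nat.lt_succ_iff_lt_or_eq.1 hj with hj | rfl
      · exact h1.closed j hj y hy
      · rw [h1.current _ le_rfl hH1]
        rw [hxH] at hy
        obtain ⟨i, hi, rfl⟩ := (hJM x y).1 hy
        exact h2 i hi
    · exact fun j hj hj' => h1.current j (by omega) hj'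

/-- The arrays used by the search. -/
def searchArrs : List Arr := [.comp, .queue, .qHead, .qTail, .numComp]

/-- The time is amortised: each start costs a constant, and all other work is charged to the
processed queue entries via `searchCost`. Between two starts the queue is empty, so the labels found
so far form entire components. -/
theorem components_spec (hN : M .numCol 0 0 = N)
    (hJ : ∀ x y, Joined M x y → Joined M y x) (hJN : ∀ x y, Joined M x y → 1 ≤ y ∧ y ≤ N)
    (hblank : ∀ A ∈ searchArrs, ∀ i j, M A i j = 0) :
    Spec components M (100 * (N + ∑ c ∈ Finset.range (N + 1), M .gLen c 0 + 1)) fun _ M' =>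
      Frame searchArrs M M' ∧
      (∀ c, 1 ≤ c → c ≤ N → 1 ≤ M' .comp c 0 ∧ M' .comp c 0 ≤ M' .numComp 0 0) ∧
      (∀ c c', 1 ≤ c → c ≤ N →
        (M' .comp c 0 = M' .comp c' 0 ↔ ReflTransGen (Joined M) c c')) ∧
      ∀ k, 1 ≤ k → k ≤ M' .numComp 0 0 → ∃ c, 1 ≤ c ∧ c ≤ N ∧ M' .comp c 0 = k := by
  have hb : ∀ {A : Arr}, A ∈ searchArrs → ∀ i j, M A i j = 0 := fun hA i j => hblank _ hA i j
  simp only [components, Spec, wp_bind, wp_get, wp_zero, hN]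
  refine wp_forLoop_amortised (fun i M' s' => Frame searchArrs M M' ∧
    Search (Joined M) N (M' .qHead 0 0) (M' .numComp 0 0) M' ∧
    M' .qHead 0 0 = M' .qTail 0 0 ∧ (∀ c, 1 ≤ c → c ≤ i → M' .comp c 0 ≠ 0) ∧
    s' ≤ i * 40 + searchCost M' (M' .qHead 0 0)) ?_ ?_ ?_
  · refine ⟨.refl _ _, ⟨?_, ?_, ?_, ?_, ?_, ?_, ?_, ?_, ?_⟩, ?_, by omega, by omega⟩
    all_goals simp only [hb (A := .comp) (by decide), hb (A := .qTail) (by decide),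
      hb (A := .qHead) (by decide), hb (A := .numComp) (by decide)]
    all_goals omega
  · rintro i hi M₁ s₁ ⟨hF, h1, hht, hvis, hs⟩
    simp only [wp_bind, wp_succ, wp_getAt, wp_eq, wp_ite, wp_pure, decide_eq_true_eq]
    split
    · rename_i hi0
      simp only [wp_increment]
      set M₂ := M₁.set .numComp 0 0 (M₁ .numComp 0 0 + 1) with hM₂
      have hF₂ : Frame [.numComp] M₁ M₂ := (Frame.refl _ _).set (by decide) _ _ _
      have hnum : M₂ .numComp 0 0 = M₁ .numComp 0 0 + 1 := by simp [hM₂, Mem.set]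
      have h2 := h1.frame hF₂
      refine (visit_spec hJ h2 (c := i + 1) (by rw [hF₂ .comp (by decide)]; exact hi0)
        (by omega) (by omega) (by omega) (by omega) ?_ ?_).wp ?_
      · intro c' hc'
        have := h2.comp_le c'
        omega
      · intro j hj hj'
        have := hF₂ .qTail (by decide)
        rw [this] at hj'
        omega
      rintro - M₃ s₃ ⟨hF₃, h3, hG₃, h4, h5⟩ hs₃
      set K := M₂ .numComp 0 0 with hK
      have hG₃' : Grows M₁ M₃ := (Grows.of_frame hF₂).trans hG₃
      have hF₃' : Frame searchArrs M M₃ :=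
        hF.trans ((hF₂.mono (by decide)).trans (hF₃.mono (by decide)))
      have hhead : M₃ .qHead 0 0 = M₁ .qHead 0 0 := by
        rw [hF₃ .qHead (by decide), hF₂ .qHead (by decide)]
      have hcost : searchCost M₃ (M₁ .qHead 0 0) = searchCost M₁ (M₁ .qHead 0 0) :=
        searchCost_congr (by rw [hF₃ .gLen (by decide), hF₂ .gLen (by decide)]) hG₃' hht.le
      -- The time spent in this loop is paid for by the increase of `searchCost` since its start.
      -- The measure works because each round advances the head, which never passes the tail, and
      -- the tail is at most N.
      refine wp_whileLoop (fun M' s' => Frame searchArrs M M' ∧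
        Search (Joined M) N (M' .qHead 0 0) K M' ∧ M' .numComp 0 0 = K ∧ Grows M₃ M' ∧
        s' + searchCost M₁ (M₁ .qHead 0 0) ≤ searchCost M' (M' .qHead 0 0))
        (fun M' => N - M' .qHead 0 0) (fun M' => decide (M' .qHead 0 0 < M' .qTail 0 0)) 5
        (fun M' => rfl) ?_ (Nat.sub_le _ _) ?_ ?_
      · refine ⟨hF₃', by rwa [hhead], by rw [hF₃ .numComp (by decide)], .refl _, ?_⟩
        rw [hhead, hcost, Nat.zero_add]
      · rintro M₄ s₄ ⟨hF₄, h6, h7, hG₄, hc₄⟩ hlt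
        have hlt : M₄ .qHead 0 0 < M₄ .qTail 0 0 := by simpa using hlt
        simp only [wp_bind, wp_get, wp_getAt, wp_increment]
        set H := M₄ .qHead 0 0 with hH
        set M₅ := M₄.set .qHead 0 0 (H + 1) with hM₅
        have hF₅ : Frame [.qHead] M₄ M₅ := (Frame.refl _ _).set (by decide) _ _ _
        have h8 := h6.frame hF₅
        have hq : M₄ .queue H 0 = M₅ .queue H 0 := by rw [hF₅ .queue (by decide)]
        have hF₅' : Frame searchArrs M M₅ := hF₄.trans (hF₅.mono (by decide))
        have hH₅ : M₅ .qHead 0 0 = H + 1 := by simp [hM₅, Mem.set]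
        rw [hq]
        refine (process_spec hJ hJN h8 (by rwa [hF₅ .qTail (by decide)])
          (by rw [hF₅ .numComp (by decide), h7]) (by omega)
          (fun x y => (Joined.frame hF₅').symm)).wp ?_
        rintro - M₆ s₆ ⟨hF₆, h9, hG₆⟩ hs₆
        have hH₆ : M₆ .qHead 0 0 = H + 1 := by rw [hF₆ .qHead (by decide), hH₅]
        have hG₅ : Grows M₄ M₅ := Grows.of_frame hF₅
        have hc₅ : searchCost M₆ H = searchCost M₄ H := searchCost_congr
          (by rw [hF₆ .gLen (by decide), hF₅ .gLen (by decide)]) (hG₅.trans hG₆) hlt.le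
        have hc₆ : searchCost M₆ (H + 1) =
            searchCost M₄ H + (20 + 20 * M₅ .gLen (M₅ .queue H 0) 0) := by
          rw [← hc₅]
          unfold searchCost
          rw [Finset.sum_range_succ, hF₆ .gLen (by decide),
            hG₆.queue H (by rwa [hF₅ .qTail (by decide)])]
        have h10 := h9.tail_le
        have h11 := h9.head_le
        refine ⟨⟨hF₅'.trans (hF₆.mono (by decide)), by rwa [hH₆],
          by rw [hF₆ .numComp (by decide), hF₅ .numComp (by decide), h7],
          hG₄.trans (hG₅.trans hG₆), ?_⟩, ?_⟩
        -- A round takes at most 18 + 18g steps, g being the degree of the processed colour, while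
        -- `searchCost` grows by 20 + 20g.
        · rw [hH₆, hc₆]
          omega
        · omega
      · rintro M₄ s₄ s₅ ⟨hF₄, h6, h7, hG₄, hc₄⟩ hlt hs₅
        have hlt : ¬ M₄ .qHead 0 0 < M₄ .qTail 0 0 := by simpa using hlt
        have := h6.head_le
        refine ⟨hF₄, by rwa [h7], by omega, fun c hc hc' => ?_, ?_⟩
        · rcases Nat.lt_succ_iff_lt_or_eq.1 (Nat.lt_succ_of_le hc') with hc' | rfl
          · have h12 := hvis c hc (by omega)
            have h13 := hG₃'.comp c h12
            rw [hG₄.comp c (by omega), h13]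
            exact h12
          · rw [hG₄.comp _ (by omega), h4]
            omega
        · omega
    · rename_i hi0
      refine ⟨hF, h1, hht, fun c hc hc' => ?_, by omega⟩
      rcases Nat.lt_succ_iff_lt_or_eq.1 (Nat.lt_succ_of_le hc') with hc' | rfl
      · exact hvis c hc (by omega)
      · exact hi0
  · rintro M₁ s₁ ⟨hF, h1, hht, hvis, hs⟩
    refine ⟨⟨hF, fun c hc hc' => ⟨Nat.pos_of_ne_zero (hvis c hc hc'), h1.comp_le c⟩,
      fun c c' hc hc' => ⟨fun hcc => h1.conn c c' hcc (hvis c hc hc'), fun hcc => ?_⟩,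
      fun k hk hk' => ?_⟩, ?_⟩
    · have hvc := hvis c hc hc'
      suffices M₁ .comp c' 0 = M₁ .comp c 0 from this.symm
      induction hcc with
      | refl => rfl
      | tail _ h ih =>
        obtain ⟨j, hj, hjq⟩ := (h1.comp_iff _).1 (by rw [ih]; exact hvc)
        have := h1.closed j (by omega) _ (by rw [hjq]; exact h)
        rw [this, hjq, ih]
    · obtain ⟨c, hc⟩ := h1.surj k hk hk'
      obtain ⟨j, hj, rfl⟩ := (h1.comp_iff c).1 (by omega)
      exact ⟨_, (h1.range j hj).1, (h1.range j hj).2, hc⟩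
    · have := h1.cost_le
      rw [← hht, hF .gLen (by decide)] at this
      omega

/-! ## Collecting the classes -/

/-- Phrased through membership in a row, because the order of the entries does not matter for
`outClass`. -/
theorem collectClasses_spec (hblank : ∀ k, M .clsLen k 0 = 0) :
    Spec collectClasses M (20 * M .eLen 0 0 + 5) fun _ M' =>
      Frame [.clsLen, .cls] M M' ∧ ∀ k i, (∃ t < M' .clsLen k 0, M' .cls k t = i) ↔
        i < M .eLen 0 0 ∧ M .comp (M .col (M .eFst i 0) (M .eSnd i 0)) 0 = k := by
  simp only [collectClasses, Spec, wp_bind, wp_get]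
  refine wp_forLoop (fun m M' => Frame [.clsLen, .cls] M M' ∧
    ∀ k i, (∃ t < M' .clsLen k 0, M' .cls k t = i) ↔
      i < m ∧ M .comp (M .col (M .eFst i 0) (M .eSnd i 0)) 0 = k) 16
    ⟨.refl _ _, by simp [hblank]⟩ ?_ fun M' s h hs => ⟨h, by omega⟩
  rintro i hi M₁ ⟨hF, h1⟩
  simp only [Spec, wp_bind, wp_getAt, wp_load, wp_pushRow]
  rw [hF .eFst (by decide), hF .eSnd (by decide), hF .col (by decide), hF .comp (by decide)]
  set k₀ := M .comp (M .col (M .eFst i 0) (M .eSnd i 0)) 0 with hk₀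
  refine ⟨⟨(hF.set (by decide) _ _ _).set (by decide) _ _ _, fun k j => ?_⟩, by omega⟩
  have := h1 k j
  by_cases hk : k = k₀
  · subst hk
    simp only [Mem.set, reduceCtorEq, false_and, if_false, and_self, if_true,
      true_and, Nat.exists_lt_succ_right]
    have hlt : ∀ t < M₁ .clsLen k₀ 0, t ≠ M₁ .clsLen k₀ 0 := fun t ht => ht.ne
    have e : (∃ t < M₁ .clsLen k₀ 0, (if t = M₁ .clsLen k₀ 0 then i else M₁ .cls k₀ t) = j) ↔
        ∃ t < M₁ .clsLen k₀ 0, M₁ .cls k₀ t = j :=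
      exists_congr fun t => and_congr_right fun ht => by rw [if_neg (hlt t ht)]
    rw [e, this]
    constructor
    · rintro (⟨h2, h3⟩ | rfl)
      · exact ⟨by omega, h3⟩
      · exact ⟨by omega, rfl⟩
    · rintro ⟨h2, h3⟩
      rcases Nat.lt_succ_iff_lt_or_eq.1 h2 with h2 | rfl
      exacts [.inl ⟨h2, h3⟩, .inr rfl]
  · simp only [Mem.set, reduceCtorEq, false_and, and_false, if_false, hk]
    rw [this]
    constructor
    · rintro ⟨h2, h3⟩
      exact ⟨by omega, h3⟩
    · rintro ⟨h2, h3⟩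
      rcases Nat.lt_succ_iff_lt_or_eq.1 h2 with h2 | rfl
      exacts [⟨h2, h3⟩, absurd h3.symm hk]

end Components

/-! ## Correctness and running time -/

section Main

open Relation (ReflTransGen TransGen)

variable {V : Type*} {n : ℕ}

/-- Along a path in the colour graph, consecutive colours meet on an edge, which yields a chain for
R. Conversely, two edges sharing a colour c have stored colours both connected to c. -/
theorem reflTransGen_joined_iff {num : V ≃ Fin n} {P : Sym2 V → ℕ → Prop} {T : ℕ} {M : Mem}
    (h : Painted num P T M) {R : Sym2 V → Sym2 V → Prop}
    (hR : ∀ e f, (∃ c, P e c ∧ P f c) ↔ R e f) {a b a' b' : V} (hab : ∃ c, P s(a, b) c)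
    (hab' : ∃ c, P s(a', b') c) :
    ReflTransGen (Joined M) (M .col (code num a) (code num b))
      (M .col (code num a') (code num b')) ↔ TransGen R s(a, b) s(a', b') := by
  have hcol : ∀ u w, (∃ c, P s(u, w) c) → P s(u, w) (M .col (code num u) (code num w)) :=
    fun u w ⟨c, hc⟩ => h.col_mem u w fun h0 => h.col_zero u w c h0 hc
  have hsymm : ∀ {x y}, ReflTransGen (Joined M) x y → ReflTransGen (Joined M) y x :=
    fun {x y} hxy => by
    induction hxy with
    | refl => exact .refl
    | tail _ hj ih => exact ih.head (h.joined_symm _ _ hj)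
  constructor
  · have key : ∀ x y, ReflTransGen (Joined M) x y → ∀ e f, P e x → P f y → TransGen R e f := by
      intro x y hxy
      induction hxy with
      | refl => exact fun e f he hf => .single ((hR e f).1 ⟨x, he, hf⟩)
      | tail _ hj ih =>
        intro e f he hf
        obtain ⟨g, hg, hg'⟩ := h.joined_mem _ _ hj
        exact (ih e g he hg).tail ((hR g f).1 ⟨_, hg', hf⟩)
    exact fun hxy => key _ _ hxy _ _ (hcol a b hab) (hcol a' b' hab')
  · have step : ∀ a b a' b', R s(a, b) s(a', b') →
        ReflTransGen (Joined M) (M .col (code num a) (code num b))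
          (M .col (code num a') (code num b')) := by
      intro a b a' b' hr
      obtain ⟨c, hc, hc'⟩ := (hR _ _).2 hr
      exact (hsymm (h.conn a b c hc)).trans (h.conn a' b' c hc')
    have key : ∀ f, TransGen R s(a, b) f → ∀ a' b', f = s(a', b') →
        ReflTransGen (Joined M) (M .col (code num a) (code num b))
          (M .col (code num a') (code num b')) := by
      intro f hf
      induction hf with
      | single hr =>
        rintro a' b' rfl
        exact step _ _ _ _ hr
      | @tail g f _ hr ih =>
        rintro a' b' rfl
        induction g with | _ u w =>
        exact (ih u w rfl).trans (step _ _ _ _ hr)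
    exact fun hf => key _ hf _ _ rfl

/-- The relation `P` between edges and colours generates the relation `R` on edges, and
`1, …, N` are the colours in use. -/
structure Colouring (P : Sym2 V → ℕ → Prop) (R : Sym2 V → Sym2 V → Prop) (N : ℕ) : Prop where
  rel : ∀ e f, (∃ c, P e c ∧ P f c) ↔ R e f
  used : ∀ c, (∃ e, P e c) ↔ 1 ≤ c ∧ c ≤ N

/-- The class of an edge is the set of edges whose stored colours lie in the same component, so
component numbers and classes correspond. No component is empty of edges because every colour is
used. -/
theorem isOutput_of_painted {G : SimpleGraph V} {W : Finset V} {num : V ≃ Fin n}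
    {M₁ M₂ M₃ : Mem} {P : Sym2 V → ℕ → Prop} {T N : ℕ}
    (h : Painted num P T M₁) (hP : Colouring P (pspRelOn G (W : Set V)) N)
    (hF₂ : Frame searchArrs M₁ M₂)
    (hrange : ∀ c, 1 ≤ c → c ≤ N → 1 ≤ M₂ .comp c 0 ∧ M₂ .comp c 0 ≤ M₂ .numComp 0 0)
    (hcomp : ∀ c c', 1 ≤ c → c ≤ N →
      (M₂ .comp c 0 = M₂ .comp c' 0 ↔ ReflTransGen (Joined M₁) c c'))
    (hsurj : ∀ k, 1 ≤ k → k ≤ M₂ .numComp 0 0 → ∃ c, 1 ≤ c ∧ c ≤ N ∧ M₂ .comp c 0 = k)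
    (hF₃ : Frame [.clsLen, .cls] M₂ M₃)
    (hcls : ∀ k i, (∃ t < M₃ .clsLen k 0, M₃ .cls k t = i) ↔
      i < M₂ .eLen 0 0 ∧ M₂ .comp (M₂ .col (M₂ .eFst i 0) (M₂ .eSnd i 0)) 0 = k)
    (hself : ∀ v ∈ W, ∀ e ∈ pspEdges G v, pspRel G v e e) :
    IsOutput G W num M₃ := by
  have hinj : Function.Injective (code num) := fun u w => (code_inj num).1
  have hY : {e | ∃ c, P e c} = (pspUnion G (W : Set V)).edgeSet := by
    ext e
    rw [mem_pspUnion_edgeSet, Set.mem_ofPred_eq]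
    have : (∃ c, P e c) ↔ ∃ c, P e c ∧ P e c := by simp
    rw [this, hP.rel]
    constructor
    · rintro ⟨v, hv, -, he, -⟩
      exact ⟨v, hv, by rwa [psp_edgeSet] at he⟩
    · rintro ⟨v, hv, he⟩
      exact ⟨v, hv, hself v hv e he⟩
  have hYmem : ∀ e, (∃ c, P e c) ↔ e ∈ (pspUnion G (W : Set V)).edgeSet := fun e => by
    rw [← hY, Set.mem_ofPred_eq]
  have hF : Frame (searchArrs ++ [.clsLen, .cls]) M₁ M₃ :=
    (hF₂.mono (by decide)).trans (hF₃.mono (by decide))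
  have hedges : EdgesOut num (pspUnion G (W : Set V)).edgeSet M₁ := hY ▸ h.edges
  have hedges₃ := hedges.frame hF
  have hcol : ∀ a b, (∃ c, P s(a, b) c) →
      P s(a, b) (M₁ .col (code num a) (code num b)) :=
    fun u w ⟨c, hc⟩ => h.col_mem u w fun h0 => h.col_zero u w c h0 hc
  let κ : V → V → ℕ := fun a b => M₂ .comp (M₁ .col (code num a) (code num b)) 0
  let Φ : ℕ → Set (Sym2 V) := fun k =>
    {e | ∃ a b, e = s(a, b) ∧ (∃ c, P s(a, b) c) ∧ κ a b = k}
  have hκ : ∀ a b a' b', (∃ c, P s(a, b) c) → (∃ c, P s(a', b') c) →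
      (κ a b = κ a' b' ↔ pspRelOnStar G (W : Set V) s(a, b) s(a', b')) := by
    intro a b a' b' hab hab'
    have hc := (hP.used _).1 ⟨_, hcol a b hab⟩
    rw [pspRelOnStar, ← reflTransGen_joined_iff h hP.rel hab hab']
    exact hcomp _ _ hc.1 hc.2
  have hstar : ∀ {e f}, pspRelOnStar G (W : Set V) e f → ∃ c, P f c := by
    intro e f hef
    have : ∃ g, pspRelOn G (W : Set V) g f := by
      cases hef with
      | single h => exact ⟨_, h⟩
      | tail _ h => exact ⟨_, h⟩
    obtain ⟨g, hg⟩ := this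
    obtain ⟨c, -, hc⟩ := (hP.rel g f).2 hg
    exact ⟨c, hc⟩
  have hΦ : ∀ a b, (∃ c, P s(a, b) c) → Φ (κ a b) = {f | pspRelOnStar G (W : Set V) s(a, b) f} := by
    intro a b hab
    ext f
    simp only [Φ, Set.mem_ofPred_eq]
    constructor
    · rintro ⟨a', b', rfl, hab', hk⟩
      exact (hκ a b a' b' hab hab').1 hk.symm
    · intro hf
      have hfY := hstar hf
      induction f with | _ a' b' =>
      exact ⟨a', b', rfl, hfY, ((hκ a b a' b' hab hfY).2 hf).symm⟩
  have hout : ∀ k, outClass M₃ k = Sym2.map (code num) '' Φ k := by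
    intro k
    have hrep : ∀ i < M₁ .eLen 0 0, ∃ a b, (∃ c, P s(a, b) c) ∧ M₁ .eFst i 0 = code num a ∧
        M₁ .eSnd i 0 = code num b := by
      intro i hi
      obtain ⟨e, he, heq⟩ := h.edges.mapsTo hi
      induction e with | _ a b =>
      rw [Sym2.map_mk, outEdge, Sym2.eq_iff] at heq
      rcases heq with ⟨h1, h2⟩ | ⟨h1, h2⟩
      · exact ⟨a, b, he, h1.symm, h2.symm⟩
      · exact ⟨b, a, by rwa [Sym2.eq_swap], h2.symm, h1.symm⟩
    have hEq : ∀ i, outEdge M₃ i = outEdge M₁ i := fun i => by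
      simp only [outEdge, hF .eFst (by decide), hF .eSnd (by decide)]
    rw [hF₂ .eLen (by decide), hF₂ .eFst (by decide), hF₂ .eSnd (by decide),
      hF₂ .col (by decide)] at hcls
    ext ε
    simp only [outClass, Set.mem_ofPred_eq, Set.mem_image, hEq]
    constructor
    · rintro ⟨t, ht, rfl⟩
      obtain ⟨h1, h2⟩ := (hcls k _).1 ⟨t, ht, rfl⟩
      obtain ⟨a, b, hab, h3, h4⟩ := hrep _ h1
      rw [h3, h4] at h2
      exact ⟨s(a, b), ⟨a, b, rfl, hab, h2⟩, by rw [outEdge, h3, h4, Sym2.map_mk]⟩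
    · rintro ⟨e, ⟨a, b, rfl, hab, hk⟩, rfl⟩
      obtain ⟨i, hi, hie⟩ := h.edges.surjOn ⟨s(a, b), hab, rfl⟩
      have h2 : M₂ .comp (M₁ .col (M₁ .eFst i 0) (M₁ .eSnd i 0)) 0 = k := by
        -- The list may hold the edge in either orientation; the stored colour is symmetric.
        rw [outEdge, Sym2.map_mk, Sym2.eq_iff] at hie
        rcases hie with ⟨h3, h4⟩ | ⟨h3, h4⟩
        · rw [h3, h4]
          exact hk
        · rw [h3, h4, h.col_symm]
          exact hk
      obtain ⟨t, ht, rfl⟩ := (hcls k i).2 ⟨hi, h2⟩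
      exact ⟨t, ht, hie.symm⟩
  have hnum : M₃ .numComp 0 0 = M₂ .numComp 0 0 := by rw [hF₃ .numComp (by decide)]
  have hrep : ∀ k, 1 ≤ k → k ≤ M₂ .numComp 0 0 → ∃ a b, (∃ c, P s(a, b) c) ∧ κ a b = k := by
    intro k hk hk'
    obtain ⟨c, hc1, hc2, rfl⟩ := hsurj k hk hk'
    obtain ⟨e, he⟩ := (hP.used c).2 ⟨hc1, hc2⟩
    induction e with | _ a b =>
    exact ⟨a, b, ⟨c, he⟩, ((hcomp c _ hc1 hc2).2 (h.conn a b c he)).symm⟩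
  refine ⟨?_, hedges₃, ?_⟩
  · have hX : {x | ∃ e, (∃ c, P e c) ∧ x ∈ e} = (pspUnion G (W : Set V)).verts := by
      ext x
      rw [mem_pspUnion_verts, Set.mem_ofPred_eq]
      simp only [hYmem]
    exact hX ▸ (h.verts.frame hF).2
  · rw [hnum]
    refine ⟨fun k hk => ?_, fun k hk k' hk' hkk => ?_, ?_⟩
    · obtain ⟨a, b, hab, rfl⟩ := hrep k hk.1 hk.2
      rw [hout, hΦ a b hab]
      exact ⟨_, ⟨s(a, b), (hYmem _).1 hab, rfl⟩, rfl⟩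
    · rw [hout, hout] at hkk
      have hkk := (Sym2.map.injective hinj).image_injective hkk
      obtain ⟨a, b, hab, rfl⟩ := hrep k hk.1 hk.2
      have hmem : s(a, b) ∈ Φ (κ a b) := ⟨a, b, rfl, hab, rfl⟩
      rw [hkk] at hmem
      obtain ⟨a', b', heq, hab', rfl⟩ := hmem
      rcases Sym2.eq_iff.1 heq with ⟨rfl, rfl⟩ | ⟨rfl, rfl⟩
      · rfl
      · simp only [κ]
        rw [h.col_symm]
    · rintro _ ⟨φ, ⟨e, he, rfl⟩, rfl⟩
      induction e with | _ a b =>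
      have hab := (hYmem _).2 he
      have hc := (hP.used _).1 ⟨_, hcol a b hab⟩
      exact ⟨κ a b, hrange _ hc.1 hc.2, by rw [hout, hΦ a b hab]⟩

/-! ### Scanning the vertices of `W` and the total running time -/

variable [Fintype V] {G : SimpleGraph V} [DecidableRel G.Adj] {num : V ≃ Fin n}
  {nb : V → ℕ → V} {D : ℕ} {M : Mem}

/-- The arrays that are changed while the vertices of `W` are scanned. -/
def scanArrs : List Arr := [.count, .chord, .hit, .loc, .old, .locCol, .numCol] ++ paintArrs

/-- The time is 110 + 20 + 50 + 200 = 380 times D⁴, after the smaller powers of D are raised to D⁴.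
-/
theorem scan_spec (hM : Static G num nb D M) (v : V) {P : Sym2 V → ℕ → Prop} {T : ℕ}
    (h : Painted num P T M) {R : Sym2 V → Sym2 V → Prop}
    (hP : Colouring P R (M .numCol 0 0)) :
    Spec (do
        computeLoc (code num v)
        closeLoc (code num v)
        assignColours (code num v)
        colourPSP (code num v)) M (380 * D ^ 4) fun _ M' => Frame scanArrs M M' ∧
      M' .numCol 0 0 ≤ M .numCol 0 0 + D ∧ ∃ P', Painted num P' (T + 2 * D ^ 3) M' ∧
        Colouring P' (fun e f => R e f ∨ pspRel G v e f) (M' .numCol 0 0) := by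
  have hD := hM.pos
  have hbij := hM.bij v
  have hadj : ∀ i < G.degree v, G.Adj v (nb v i) := fun i hi => hM.adj_nb hi
  simp only [Spec, wp_bind]
  refine (computeLoc_spec hM v).wp ?_
  rintro - M₁ s₁ ⟨hF₁, h1⟩ hs₁
  have hS₁ := hM.frame hF₁
  refine (closeLoc_spec hS₁ v (R := posRel G v (nb v) (G.degree v)) (fun i k h => ⟨h.1, h.2.1⟩)
    fun i hi k hk => (h1 i hi k hk).trans ⟨fun h => ⟨hi, hk, h⟩, fun h => h.2.2⟩).wp ?_
  rintro - M₂ s₂ ⟨hF₂, h2⟩ hs₂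
  have hS₂ := hS₁.frame hF₂
  have hloc : ∀ i < G.degree v, ∀ k < G.degree v, M₂ .loc i k = 1 ↔
      localRelStar G v s(v, nb v i) s(v, nb v k) := fun i hi k hk =>
    (h2 i hi k hk).trans (transGen_posRel_iff hbij hi hk)
  refine (assignColours_spec hS₂ v
    (E := fun i k => localRelStar G v s(v, nb v i) s(v, nb v k))
    (fun i hi => localRelStar_refl (hadj i hi)) (fun i k => localRelStar_symm)
    (fun i j k => localRelStar_trans) hloc).wp ?_
  rintro - M₃ s₃ ⟨hF₃, h3, h4, h5, h6⟩ hs₃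
  have hnum : M₂ .numCol 0 0 = M .numCol 0 0 := by
    rw [hF₂ .numCol (by decide), hF₁ .numCol (by decide)]
  rw [hnum] at h3 h4 h6
  have hS₃ := hS₂.frame hF₃
  have hF : Frame [.count, .chord, .hit, .loc, .old, .locCol, .numCol] M M₃ :=
    (hF₁.mono (by decide)).trans ((hF₂.mono (by decide)).trans (hF₃.mono (by decide)))
  refine (colourPSP_spec hS₃ v (h.frame hF) (fun i hi => ?_) (fun i hi k hk => ?_)).wp ?_
  · have := (h6 _).1 ⟨i, hi, rfl⟩
    omega
  · rw [hF₃ .loc (by decide), hloc i hi k hk]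
  rintro - M₄ s₄ ⟨hF₄, h7⟩ hs₄
  have hnum₄ : M₄ .numCol 0 0 = M₃ .numCol 0 0 := hF₄ .numCol (by decide) ▸ rfl
  refine ⟨⟨(hF.mono (by decide)).trans (hF₄.mono (by decide)), by omega, _, h7, ?_⟩, ?_⟩
  · rw [hnum₄]
    constructor
    · intro e f
      rw [← hP.rel, ← exists_ownEdge_iff_pspRel hbij h5]
      -- Old colours are at most the old counter and new ones exceed it, so no colour is shared
      -- between an old and a new painting. Links between different scanned vertices arise only from
      -- edges painted twice.
      have hold : ∀ {e c}, P e c → c ≤ M .numCol 0 0 := fun {e c} hc =>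
        ((hP.used c).1 ⟨e, hc⟩).2
      have hnew : ∀ {e c}, (∃ i < G.degree v, c = M₃ .locCol i 0 ∧
          OwnEdge G v (nb v) (G.degree v) i e) → M .numCol 0 0 < c := by
        rintro e c ⟨i, hi, rfl, -⟩
        exact ((h6 _).1 ⟨i, hi, rfl⟩).1
      constructor
      · rintro ⟨c, he | he, hf | hf⟩
        · exact .inl ⟨c, he, hf⟩
        · exact absurd (hold he) (not_le.2 (hnew hf))
        · exact absurd (hold hf) (not_le.2 (hnew he))
        · exact .inr ⟨c, he, hf⟩
      · rintro (⟨c, he, hf⟩ | ⟨c, he, hf⟩)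
        · exact ⟨c, .inl he, .inl hf⟩
        · exact ⟨c, .inr he, .inr hf⟩
    · intro c
      rw [exists_or, hP.used]
      have : (∃ e, ∃ i < G.degree v, c = M₃ .locCol i 0 ∧
          OwnEdge G v (nb v) (G.degree v) i e) ↔ ∃ i < G.degree v, c = M₃ .locCol i 0 :=
        ⟨fun ⟨e, i, hi, hc, _⟩ => ⟨i, hi, hc⟩, fun ⟨i, hi, hc⟩ => ⟨_, i, hi, hc, .inl rfl⟩⟩
      rw [this, h6]
      omega
  · have hD2 := pow_le_pow_succ' hD 2
    have hD3 := pow_le_pow_succ' hD 3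
    norm_num at hD2 hD3
    omega

theorem Painted.blank (hblank : ∀ A ∈ paintArrs, ∀ i j, M A i j = 0) :
    Painted num (fun _ _ => False) 0 M where
  col_symm a b := by rw [hblank _ (by decide), hblank _ (by decide)]
  col_zero _ _ _ _ h := h
  col_mem a b h := h (hblank _ (by decide) _ _)
  conn _ _ _ h := h.elim
  joined_symm x y := by
    rintro ⟨j, hj, -⟩
    rw [hblank _ (by decide)] at hj
    omega
  joined_mem x y := by
    rintro ⟨j, hj, -⟩
    rw [hblank _ (by decide)] at hj
    omega
  sum_le K := by simp [hblank .gLen (by decide)]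
  len_le := by rw [hblank _ (by decide)]
  verts := ⟨fun x => by simp [hblank .seen (by decide)], by
    rw [hblank .vLen (by decide)]
    simp⟩
  edges := by
    rw [EdgesOut, hblank .eLen (by decide)]
    simp

theorem scanAll_spec (hM : Static G num nb D M) {m : ℕ} {ws : ℕ → V}
    (hws : ∀ j < m, M .wList j 0 = code num (ws j))
    (hblank : ∀ A ∈ paintArrs, ∀ i j, M A i j = 0) (hnum : M .numCol 0 0 = 0) :
    Spec (.forLoop m fun s => do
        let v ← getAt .wList s
        computeLoc v
        closeLoc v
        assignColours v
        colourPSP v) M (m * (382 * D ^ 4 + 1) + 1) fun _ M' => Frame scanArrs M M' ∧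
      M' .numCol 0 0 ≤ m * D ∧ ∃ P, Painted num P (m * (2 * D ^ 3)) M' ∧
        Colouring P (fun e f => ∃ j < m, pspRel G (ws j) e f) (M' .numCol 0 0) := by
  refine wp_forLoop (fun s M' => Frame scanArrs M M' ∧
      M' .numCol 0 0 ≤ s * D ∧ ∃ P, Painted num P (s * (2 * D ^ 3)) M' ∧
        Colouring P (fun e f => ∃ j < s, pspRel G (ws j) e f) (M' .numCol 0 0)) (382 * D ^ 4)
    ⟨.refl _ _, by omega, _, (Painted.blank hblank).congr (fun _ _ => Iff.rfl) (by omega),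
      ⟨by simp, fun c => by simp; omega⟩⟩ ?_ fun M' s h hs => ⟨h, by omega⟩
  rintro i hi M₁ ⟨hF, h1, P, h2, h3⟩
  have hS := hM.frame hF
  rw [Spec, wp_bind, wp_getAt, hF .wList (by decide), hws i hi]
  refine (scan_spec hS (ws i) h2 h3).wp ?_
  rintro - M₂ s ⟨hF₂, h4, P', h5, h6⟩ hs
  have hpow := Nat.one_le_pow 4 D hM.pos
  refine ⟨⟨hF.trans hF₂, ?_, P', h5.congr (fun _ _ => Iff.rfl) ?_, ?_⟩, by omega⟩
  · rw [Nat.succ_mul]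
    omega
  · exact (Nat.succ_mul _ _).ge
  · exact ⟨fun e f => by rw [h6.rel, Nat.exists_lt_succ_right], h6.used⟩

/-- With at most |W|·D colours, adjacency lists of total length at most 4|W|·D³ and at most 2|W|·D³
output edges, search and collection stay within the cost O(n · D⁴) of the scan. -/
theorem localRW_spec {W : Finset V} (hin : IsInput G W num M) (hn : 1 ≤ n) (hD : 1 ≤ D)
    (hle : ∀ v, G.degree v ≤ D) :
    Spec localRW M (2000 * (n * D ^ 4)) fun _ M' => IsOutput G W num M' := by
  -- Beyond the degree the neighbour function takes the irrelevant value v.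
  have hnb : ∀ v k, ∃ u, k < G.degree v → u ∈ G.neighborSet v ∧
      code num u = M .nbr (code num v) k := by
    intro v k
    by_cases hk : k < G.degree v
    · obtain ⟨u, hu⟩ := (hin.nbr v).mapsTo hk
      exact ⟨u, fun _ => hu⟩
    · exact ⟨v, fun h => absurd h hk⟩
  choose nb hnb using hnb
  have hbij : ∀ v, Set.BijOn (nb v) (Set.Iio (G.degree v)) (G.neighborSet v) := by
    intro v
    refine ⟨fun k hk => (hnb v k hk).1, fun k hk k' hk' hkk => ?_, fun u hu => ?_⟩
    · refine (hin.nbr v).injOn hk hk' ?_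
      rw [← (hnb v k hk).2, ← (hnb v k' hk').2, hkk]
    · obtain ⟨k, hk, hku⟩ := (hin.nbr v).surjOn ⟨u, hu, rfl⟩
      refine ⟨k, hk, ?_⟩
      simp only at hku
      rwa [← (hnb v k hk).2, code_inj] at hku
  have hW : ∀ j, ∃ v, j < W.card → v ∈ W ∧ code num v = M .wList j 0 := by
    intro j
    by_cases hj : j < W.card
    · obtain ⟨v, hv⟩ := hin.wList.mapsTo hj
      exact ⟨v, fun _ => hv⟩
    -- An arbitrary vertex as default beyond the end of the list.
    · exact ⟨num.symm ⟨0, hn⟩, fun h => absurd h hj⟩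
  choose ws hws using hW
  have hWrel : ∀ e f, (∃ j < W.card, pspRel G (ws j) e f) ↔ pspRelOn G (W : Set V) e f := by
    intro e f
    constructor
    · rintro ⟨j, hj, h⟩
      exact ⟨ws j, (hws j hj).1, h⟩
    · rintro ⟨v, hv, h⟩
      obtain ⟨j, hj, hjv⟩ := hin.wList.surjOn ⟨v, hv, rfl⟩
      simp only at hjv
      rw [← (hws j hj).2, code_inj] at hjv
      exact ⟨j, hj, hjv ▸ h⟩
  have hWn : W.card ≤ n := by
    have := Finset.card_le_univ W
    rwa [Fintype.card_congr num, Fintype.card_fin] at this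
  simp only [localRW, Spec, wp_bind, wp_get]
  refine (buildAdj_spec hbij hD hle hin.size hin.deg (fun v k hk => ((hnb v k hk).2).symm)
    (fun i j => hin.blank _ _ _ nofun nofun nofun nofun nofun)).wp ?_
  rintro - M₁ s₁ ⟨hS₁, hF₁⟩ hs₁
  have hblank₁ : ∀ A, A ∉ [.size, .deg, .nbr, .wLen, .wList, .adj] → ∀ i j, M₁ A i j = 0 := by
    intro A hA i j
    simp only [List.mem_cons, not_or] at hA
    rw [hF₁ A (by simpa using hA.2.2.2.2.2)]
    exact hin.blank A i j hA.1 hA.2.1 hA.2.2.1 hA.2.2.2.1 hA.2.2.2.2.1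
  rw [hF₁ .wLen (by decide), hin.wLen]
  refine (scanAll_spec hS₁ (ws := ws) (fun j hj => ?_) (fun A hA => hblank₁ A ?_)
    (hblank₁ _ (by decide) _ _)).wp ?_
  · rw [hF₁ .wList (by decide), (hws j hj).2]
  · revert A
    decide
  rintro - M₂ s₂ ⟨hF₂, hN, P, hP, hC⟩ hs₂
  have hC : Colouring P (pspRelOn G (W : Set V)) (M₂ .numCol 0 0) :=
    ⟨fun e f => (hC.rel e f).trans (hWrel e f), hC.used⟩
  have hblank₂ : ∀ A, A ∉ [.size, .deg, .nbr, .wLen, .wList, .adj] ++ scanArrs →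
      ∀ i j, M₂ A i j = 0 := by
    intro A hA i j
    rw [List.mem_append, not_or] at hA
    rw [hF₂ A hA.2, hblank₁ A hA.1]
  refine (components_spec rfl hP.joined_symm (fun x y hxy => ?_) (fun A hA => hblank₂ A ?_)).wp ?_
  · obtain ⟨e, -, he⟩ := hP.joined_mem x y hxy
    exact (hC.used y).1 ⟨e, he⟩
  · revert A
    decide
  rintro - M₃ s₃ ⟨hF₃, h1, h2, h3⟩ hs₃
  refine (collectClasses_spec fun k => ?_).wp ?_
  · rw [hF₃ _ (by decide)]
    exact hblank₂ _ (by decide) _ _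
  rintro - M₄ s₄ ⟨hF₄, h4⟩ hs₄
  refine ⟨isOutput_of_painted hP hC hF₃ h1 h2 h3 hF₄ h4 fun v _ e he => pspRel_self (hbij v) he,
    ?_⟩
  have hsum := hP.sum_le (M₂ .numCol 0 0 + 1)
  have hlen := hP.len_le
  rw [hF₃ .eLen (by decide)] at hs₄
  have e1 : W.card * D ≤ n * D ^ 4 :=
    Nat.mul_le_mul hWn (Nat.le_self_pow (by norm_num) D)
  have e2 : W.card * (2 * D ^ 3) ≤ 2 * (n * D ^ 4) := by
    calc W.card * (2 * D ^ 3) ≤ n * (2 * D ^ 4) :=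
          Nat.mul_le_mul hWn (Nat.mul_le_mul le_rfl (Nat.pow_le_pow_right hD (by norm_num)))
      _ = 2 * (n * D ^ 4) := by ring
  have hD4 := Nat.one_le_pow 4 D hD
  have e3 : W.card * (382 * D ^ 4 + 1) ≤ 383 * (n * D ^ 4) := by
    calc W.card * (382 * D ^ 4 + 1) ≤ n * (383 * D ^ 4) := Nat.mul_le_mul hWn (by omega)
      _ = 383 * (n * D ^ 4) := by ring
  have e4 : n * (12 * D) ≤ 12 * (n * D ^ 4) := by
    calc n * (12 * D) ≤ n * (12 * D ^ 4) :=
          Nat.mul_le_mul le_rfl (Nat.mul_le_mul le_rfl (Nat.le_self_pow (by norm_num) D))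
      _ = 12 * (n * D ^ 4) := by ring
  have e5 : 1 ≤ n * D ^ 4 := Nat.mul_pos hn hD4
  omega

end Main

end PSP

theorem mainTheorem6 :
    ∃ C : ℕ, ∀ {V : Type*} [Fintype V] (G : SimpleGraph V) [DecidableRel G.Adj] (W : Finset V)
      {n : ℕ} (num : V ≃ Fin n) (M : PSP.Mem),
      (G.induce (W : Set V)).Connected →
      PSP.IsInput G W num M →
        PSP.IsOutput G W num (PSP.localRW.run M).mem ∧
        (PSP.localRW.run M).steps ≤ C * (Fintype.card V * max 1 G.maxDegree ^ 4) := by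
  refine ⟨2000, fun {V} _ G _ W {n} num M hconn hin => ?_⟩
  -- A vertex exists, so n ≥ 1 and the constant overhead is absorbed by n · D⁴ with D = max 1 Δ.
  obtain ⟨v⟩ := hconn.nonempty
  have hn : 1 ≤ n := Nat.one_le_iff_ne_zero.2 fun h => by
    subst h
    exact (num v.1).elim0
  have hcard : Fintype.card V = n := by rw [Fintype.card_congr num, Fintype.card_fin]
  have h := PSP.localRW_spec hin hn (le_max_left 1 G.maxDegree)
    fun v => (G.degree_le_maxDegree v).trans (le_max_right _ _)
  rw [hcard]
  exact ⟨h.1, by simpa using h.2⟩
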